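/- Let $S\subseteq C^*(S)$ be a separable operator system, that is, a norm-separable self-adjoint linear subspace, containing the unit, of a unital $C^*$-algebra $C^*(S)$ that is generated by $S$ as a $C^*$-algebra. Let $H_0$ be a separable complex Hilbert space and let $\phi_0:S\to\mathcal B(H_0)$ be a unital completely positive (UCP) map. Then there are a separable Hilbert space $H\supseteq H_0$ and a UCP map $\phi:S\to\mathcal B(H)$ such that (1) $\phi$ is a dilation of $\phi_0$: $P_{H_0}\phi(x)\restriction_{H_0}=\phi_0(x)$ for all $x\in S$; (2) $\phi$ has the unique extension property: $\phi$ has exactly one completely positive extension $\tilde\phi:C^*(S)\to\mathcal B(H)$, and $\tilde\phi$ is a representation of $C^*(S)$ on $H$; (3) $\phi$ is maximal: for every Hilbert space $K\supseteq H$ and every UCP map $\phi':S\to\mathcal B(K)$ with $P_H\phi'(x)\restriction_H=\phi(x)$ for all $x\in S$, one has $\phi'=\phi\oplus\psi$ for some UCP map $\psi:S\to\mathcal B(K\ominus H)$. (Inclusions of Hilbert spaces are understood up to isometric embedding.) -/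

import Mathlib

open scoped CStarAlgebra InnerProductSpace

universe u v w

/-- An operator system `S ⊆ C*(S)`: a self-adjoint linear subspace of a unital C⋆-algebra `A` that
contains the unit and generates `A` as a C⋆-algebra, so that `A = C*(S)`. -/
structure OperatorSystem (A : Type u) [CStarAlgebra A] extends Submodule ℂ A where
  one_mem' : (1 : A) ∈ carrier
  star_mem' : ∀ {a : A}, a ∈ carrier → star a ∈ carrier
  generates' : (StarAlgebra.adjoin ℂ carrier).topologicalClosure = ⊤

namespace OperatorSystem

variable {A : Type u} [CStarAlgebra A]

/-- Linear maps `S → B(H)`. -/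
abbrev OpMap (S : OperatorSystem A) (H : Type v) [NormedAddCommGroup H] [InnerProductSpace ℂ H] :
    Type (max u v) :=
  S.toSubmodule →ₗ[ℂ] (H →L[ℂ] H)

/-- Dilation: with `H₀` regarded as a subspace of `H` by means of the isometry `V`, the compression
of `φ` to `H₀` is `φ₀`, that is, `φ₀ x = V* φ(x) V` for all `x ∈ S`. -/
def IsDilation {S : OperatorSystem A}
    {H₀ : Type v} [NormedAddCommGroup H₀] [InnerProductSpace ℂ H₀] [CompleteSpace H₀]
    {H : Type w} [NormedAddCommGroup H] [InnerProductSpace ℂ H] [CompleteSpace H]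
    (φ₀ : S.OpMap H₀) (V : H₀ →ₗᵢ[ℂ] H) (φ : S.OpMap H) : Prop :=
  ∀ x, φ₀ x = ContinuousLinearMap.adjoint V.toContinuousLinearMap ∘L φ x ∘L
    V.toContinuousLinearMap

variable [PartialOrder A] [StarOrderedRing A] {S : OperatorSystem A}
  {H : Type v} [NormedAddCommGroup H] [InnerProductSpace ℂ H] [CompleteSpace H]

/-- `φ : S → B(H)` is completely positive: every matrix over `S` that is positive in `Mₙ(A)` is
mapped entrywise to a positive element of `Mₙ(B(H))`. -/
def IsCompletelyPositive (φ : S.OpMap H) : Prop :=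
  ∀ (n : ℕ) (M : CStarMatrix (Fin n) (Fin n) S.toSubmodule),
    0 ≤ M.map (Subtype.val : S.toSubmodule → A) → 0 ≤ M.map φ

/-- Unital completely positive maps. -/
structure IsUCP (φ : S.OpMap H) : Prop where
  map_one : φ ⟨1, S.one_mem'⟩ = 1
  completelyPositive : IsCompletelyPositive φ

/-- The completely positive map `ψ : C*(S) → B(H)` extends `φ : S → B(H)`. -/
def IsCPExtension (φ : S.OpMap H) (ψ : A →CP (H →L[ℂ] H)) : Prop :=
  ∀ x : S.toSubmodule, ψ (x : A) = φ x

/-- The unique extension property: `φ` has a unique completely positive extension to `C*(S)`, and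
that extension is a representation. -/
structure HasUniqueExtensionProperty (φ : S.OpMap H) : Prop where
  existsUnique_extension : ∃! ψ : A →CP (H →L[ℂ] H), IsCPExtension φ ψ
  representation : ∀ ψ : A →CP (H →L[ℂ] H), IsCPExtension φ ψ →
    ∃ π : A →⋆ₐ[ℂ] (H →L[ℂ] H), ∀ a, ψ a = π a

/-- `φ` is maximal: every UCP dilation `φ'` of `φ`, on a Hilbert space `K` that contains `H` by means
of an isometry `V`, is a direct sum `φ ⊕ ψ` for a UCP map `ψ` acting on the orthogonal complement
of `H` in `K`. -/
def IsMaximal (φ : S.OpMap H) : Prop :=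
  ∀ (K : Type w) [NormedAddCommGroup K] [InnerProductSpace ℂ K] [CompleteSpace K]
    (V : H →ₗᵢ[ℂ] K) (φ' : S.OpMap K), IsUCP φ' → IsDilation φ V φ' →
    ∃ ψ : S.OpMap (LinearMap.range V.toLinearMap)ᗮ, IsUCP ψ ∧
      ∀ (x : S.toSubmodule) (ξ : H) (η : (LinearMap.range V.toLinearMap)ᗮ),
        φ' x (V ξ + (η : K)) = V (φ x ξ) + (ψ x η : K)

end OperatorSystem

/-! Passing to a UCP dilation `φ'` of `φ` on `K ⊇ H` can only increase the norms `‖φ(x)ξ‖` for `x ∈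
S`, `ξ ∈ H`, because `φ(x)ξ` is the projection of `φ'(x)ξ` to `H`. Equality of the norms forces
`φ'(x)ξ = φ(x)ξ`. The theorem therefore asks for a dilation of `φ₀` whose norms no further dilation
can increase.

Such a dilation comes from a greedy choice, with no transfinite induction. Since `S × H` is
separable, all norms are recorded by one bounded number, a weighted sum over a dense sequence of
pairs. Choosing successive dilations within `1/(n+1)` of the supremum and passing to the limit
freezes the norms at the vectors of the original space (`exists_maximal_on`). Iterating this
countably often and taking the limit again freezes them on a dense set of vectors of the final
space, hence everywhere (`exists_maximal`).

For the resulting `φ`, every UCP dilation `ψ` leaves `H` invariant; the nonseparable case reduces to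
a separable subspace (`IsDilation.apply_of_maximal`). As `ψ` preserves adjoints, `H` reduces `ψ`,
which is maximality. If a completely positive map on `C*(S)` extends `φ`, its Stinespring
representation restricts on `S` to a dilation of `φ`; so `H` is invariant under `S`, hence under
`C*(S)`, and the extension is itself a representation. Two representations that agree on `S` are
equal.

The existence of extensions and Stinespring's theorem are obtained together
(`IsUCP.exists_representation`): `φ` is a positive functional on `S`-valued kernels over `H`, M.
Riesz extends it to `A`-valued kernels, and a GNS construction turns the extension into a
representation. -/

section

open scoped ComplexOrder

set_option linter.unusedSectionVars false

/-! ### Positivity of matrices over a C⋆-algebra. -/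

section CStarAlgebra

variable {B : Type*} [NonUnitalCStarAlgebra B] [PartialOrder B] [StarOrderedRing B]

lemma exists_eq_star_mul_self_of_nonneg {a : B} (ha : 0 ≤ a) : ∃ c, a = star c * c :=
  CStarAlgebra.nonneg_iff_eq_star_mul_self.mp ha

/-- The negative part `c` of a self-adjoint element `a` satisfies `c a c = -c³`, and `a` is positive
if `c³ = 0`. -/
lemma exists_nonneg_conjugate_eq_neg {a : B} (ha : IsSelfAdjoint a) :
    ∃ c : B, 0 ≤ c ∧ star c * a * c = -(star c * c * c) ∧ (star c * c * c = 0 → 0 ≤ a) := by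
  have h0 : 0 ≤ a⁻ := CFC.negPart_nonneg a
  have hs : star a⁻ = a⁻ := h0.isSelfAdjoint
  refine ⟨a⁻, h0, ?_, fun h2 => ?_⟩
  · have h : a⁻ * a = -(a⁻ * a⁻) := by
      nth_rewrite 2 [← CFC.posPart_sub_negPart a ha]
      rw [mul_sub, CFC.negPart_mul_posPart, zero_sub]
    rw [hs, h, neg_mul]
  · rw [hs] at h2
    have h4 : star (a⁻ * a⁻) * (a⁻ * a⁻) = 0 := by
      rw [star_mul, hs, ← mul_assoc, h2, zero_mul]
    have h5 := (CStarRing.star_mul_self_eq_zero_iff _).mp h4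
    nth_rewrite 1 [← hs] at h5
    exact (CFC.negPart_eq_zero_iff a ha).mp ((CStarRing.star_mul_self_eq_zero_iff _).mp h5)

end CStarAlgebra

namespace CStarMatrix

variable {n : Type*} [Fintype n] {A : Type*} [CStarAlgebra A] [PartialOrder A] [StarOrderedRing A]

/-- The quadratic form `b ↦ ∑ i j, (b i)⋆ (M i j) (b j)` of a matrix over a C⋆-algebra. -/
def quadForm (M : CStarMatrix n n A) (b : n → A) : A := ∑ i, ∑ j, star (b i) * M i j * b j

lemma quadForm_col (M N : CStarMatrix n n A) (k : n) :
    (star N * M * N) k k = quadForm M (fun i => N i k) := by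
  simp only [quadForm, mul_apply, Finset.sum_mul, star_apply]
  rw [Finset.sum_comm]

lemma star_quadForm (M : CStarMatrix n n A) (b : n → A) :
    quadForm (star M) b = star (quadForm M b) := by
  simp only [quadForm, star_sum, star_mul, star_star, star_apply]
  rw [Finset.sum_comm]
  simp [mul_assoc]

lemma quadForm_star_mul_self_nonneg (N : CStarMatrix n n A) (b : n → A) :
    0 ≤ quadForm (star N * N) b := by
  have : quadForm (star N * N) b = ∑ k, star (∑ i, N k i * b i) * (∑ i, N k i * b i) := by
    simp only [quadForm, mul_apply, star_apply, star_sum, star_mul, Finset.sum_mul,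
      Finset.mul_sum]
    rw [Finset.sum_comm_cycle]
    simp only [mul_assoc]
    refine Finset.sum_congr rfl fun k _ => ?_
    rw [Finset.sum_comm]
  rw [this]
  exact Finset.sum_nonneg fun k _ => star_mul_self_nonneg _

/-- In `M = N⋆N` the diagonal entries are sums of squares of the entries of the columns of `N`, so
they vanish only if `N` does. -/
lemma eq_zero_of_nonneg_of_diag {M : CStarMatrix n n A} (hM : 0 ≤ M) (h : ∀ k, M k k ≤ 0) :
    M = 0 := by
  obtain ⟨N, rfl⟩ := exists_eq_star_mul_self_of_nonneg hM
  have hN : N = 0 := by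
    ext i k
    have h1 : ∑ i, star (N i k) * N i k = 0 := by
      refine le_antisymm ?_ (Finset.sum_nonneg fun _ _ => star_mul_self_nonneg _)
      simpa [mul_apply, star_apply] using h k
    have h2 := (Finset.sum_eq_zero_iff_of_nonneg
      (fun i _ => star_mul_self_nonneg (N i k))).mp h1 i (Finset.mem_univ i)
    simpa using (CStarRing.star_mul_self_eq_zero_iff (N i k)).mp h2
  simp [hN]

/-- The test vectors are the columns of the negative part `c` of `M`: the diagonal of `c M c = -c³`
is then positive, while `c³ ≥ 0`, so `c³ = 0`. -/
lemma nonneg_of_isSelfAdjoint {M : CStarMatrix n n A} (hM : IsSelfAdjoint M)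
    (h : ∀ b : n → A, 0 ≤ quadForm M b) : 0 ≤ M := by
  obtain ⟨c, hc, h1, h2⟩ := exists_nonneg_conjugate_eq_neg hM
  refine h2 (eq_zero_of_nonneg_of_diag (star_left_conjugate_nonneg hc _) fun k => ?_)
  have := h (fun i => c i k)
  rw [← quadForm_col, h1] at this
  simpa using this

/-- A matrix over a C⋆-algebra is positive iff its quadratic form is. -/
theorem nonneg_iff_quadForm {M : CStarMatrix n n A} :
    0 ≤ M ↔ ∀ b : n → A, 0 ≤ quadForm M b := by
  refine ⟨fun h b => ?_, fun h => nonneg_of_isSelfAdjoint ?_ h⟩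
  · obtain ⟨N, rfl⟩ := exists_eq_star_mul_self_of_nonneg h
    exact quadForm_star_mul_self_nonneg N b
  · have hsub (P : CStarMatrix n n A) (c : ℂ) (b) :
        quadForm (c • (P - star P)) b = c • (quadForm P b - star (quadForm P b)) := by
      rw [← star_quadForm]
      simp [quadForm, Finset.smul_sum, mul_sub, sub_mul, smul_sub]
    have hq (c : ℂ) (b) : 0 ≤ quadForm (c • (M - star M)) b := by
      rw [hsub, (h b).isSelfAdjoint.star_eq, sub_self, smul_zero]
    have hsa (c : ℂ) (hc : star c = -c) : IsSelfAdjoint (c • (M - star M)) := by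
      rw [isSelfAdjoint_iff, star_smul, hc, star_sub, star_star, neg_smul, ← smul_neg, neg_sub]
    have h1 := nonneg_of_isSelfAdjoint (hsa Complex.I (by simp)) (hq _)
    have h2 := nonneg_of_isSelfAdjoint (hsa (-Complex.I) (by simp)) (hq _)
    rw [neg_smul] at h2
    have h3 := le_antisymm (neg_nonneg.mp h2) h1
    rw [smul_eq_zero_iff_right Complex.I_ne_zero, sub_eq_zero] at h3
    exact h3.symm

variable {H : Type*} [NormedAddCommGroup H] [InnerProductSpace ℂ H] [CompleteSpace H]

/-- A matrix of operators is positive iff it is positive on vectors. -/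
theorem nonneg_iff_inner {M : CStarMatrix n n (H →L[ℂ] H)} :
    0 ≤ M ↔ ∀ ξ : n → H, 0 ≤ ∑ i, ∑ j, ⟪ξ i, M i j (ξ j)⟫_ℂ := by
  constructor
  · intro h ξ
    obtain ⟨N, rfl⟩ := exists_eq_star_mul_self_of_nonneg h
    have : ∑ i, ∑ j, ⟪ξ i, (star N * N) i j (ξ j)⟫_ℂ =
        ∑ k, ⟪∑ i, N k i (ξ i), ∑ i, N k i (ξ i)⟫_ℂ := by
      simp only [mul_apply, star_apply, inner_sum, sum_inner, _root_.sum_apply,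
        mul_apply_eq_comp, ContinuousLinearMap.star_eq_adjoint,
        ContinuousLinearMap.adjoint_inner_right]
      rw [Finset.sum_comm_cycle]
      refine Finset.sum_congr rfl fun k _ => ?_
      rw [Finset.sum_comm]
    rw [this]
    exact Finset.sum_nonneg fun k _ => by
      rw [inner_self_eq_norm_sq_to_K, ← RCLike.ofReal_pow]
      exact Complex.zero_le_real.mpr (sq_nonneg _)
  · intro h
    rw [nonneg_iff_quadForm]
    intro b
    rw [ContinuousLinearMap.nonneg_iff_isPositive, ContinuousLinearMap.isPositive_iff_complex]
    intro η
    have h1 : ⟪η, quadForm M b η⟫_ℂ = ∑ i, ∑ j, ⟪b i η, M i j (b j η)⟫_ℂ := by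
      simp only [quadForm, _root_.sum_apply, inner_sum,
        mul_apply_eq_comp, ContinuousLinearMap.star_eq_adjoint,
        ContinuousLinearMap.adjoint_inner_right]
    have h2 : 0 ≤ ⟪η, quadForm M b η⟫_ℂ := h1 ▸ h fun i => b i η
    have h3 : 0 ≤ ⟪quadForm M b η, η⟫_ℂ := by
      rw [← inner_conj_symm, starRingEnd_apply]
      exact star_nonneg_iff.mpr h2
    rw [Complex.nonneg_iff] at h3
    refine ⟨?_, h3.1⟩
    apply Complex.ext
    · simp
    · simpa using h3.2

end CStarMatrix

/-! ### Complete positivity on vectors, and preservation of adjoints. -/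

namespace OperatorSystem
open CStarMatrix

variable {A : Type u} [CStarAlgebra A] [PartialOrder A] [StarOrderedRing A] {S : OperatorSystem A}
  {H : Type v} [NormedAddCommGroup H] [InnerProductSpace ℂ H] [CompleteSpace H]

/-- Complete positivity in terms of quadratic forms. -/
theorem isCompletelyPositive_iff {φ : S.OpMap H} :
    IsCompletelyPositive φ ↔ ∀ (n : ℕ) (M : Fin n → Fin n → S.toSubmodule),
      (∀ b : Fin n → A, 0 ≤ ∑ i, ∑ j, star (b i) * (M i j : A) * b j) →
        ∀ ξ : Fin n → H, 0 ≤ ∑ i, ∑ j, ⟪ξ i, φ (M i j) (ξ j)⟫_ℂ := by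
  refine forall_congr' fun n => forall_congr' fun M => ?_
  rw [nonneg_iff_quadForm, nonneg_iff_inner]
  rfl

theorem IsCompletelyPositive.sum_inner_nonneg {φ : S.OpMap H} (hφ : IsCompletelyPositive φ)
    {ι : Type*} [Fintype ι] (M : ι → ι → S.toSubmodule)
    (hM : ∀ b : ι → A, 0 ≤ ∑ i, ∑ j, star (b i) * (M i j : A) * b j) (ξ : ι → H) :
    0 ≤ ∑ i, ∑ j, ⟪ξ i, φ (M i j) (ξ j)⟫_ℂ := by
  let e := Fintype.equivFin ι
  have h := isCompletelyPositive_iff.mp hφ _ (fun i j => M (e.symm i) (e.symm j))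
    (fun b => by
      have := hM (b ∘ e)
      rw [← e.symm.sum_comp] at this
      convert this using 2 with i
      rw [← e.symm.sum_comp]
      simp) (ξ ∘ e.symm)
  rw [← e.symm.sum_comp]
  convert h using 2 with i
  rw [← e.symm.sum_comp]
  simp

lemma IsCompletelyPositive.inner_nonneg {φ : S.OpMap H} (hφ : IsCompletelyPositive φ)
    (x : S.toSubmodule) (hx : 0 ≤ (x : A)) (ξ : H) : 0 ≤ ⟪ξ, φ x ξ⟫_ℂ := by
  simpa using hφ.sum_inner_nonneg (ι := Unit) (fun _ _ => x)
    (fun b => by simpa using star_left_conjugate_nonneg hx _) (fun _ => ξ)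

/-- The adjoint on an operator system. -/
def adj (x : S.toSubmodule) : S.toSubmodule := ⟨star (x : A), S.star_mem' x.2⟩

@[simp] lemma coe_adj (x : S.toSubmodule) : (adj x : A) = star (x : A) := rfl

/-- For self-adjoint `y` both `y + ‖y‖·1` and `1` are positive, so `⟪ξ, φ y ξ⟫` is real. The general
case combines `y = x + x⋆` and `y = i(x - x⋆)`. -/
lemma IsCompletelyPositive.inner_self_adj {φ : S.OpMap H} (hφ : IsCompletelyPositive φ)
    (x : S.toSubmodule) (ξ : H) : ⟪ξ, φ (adj x) ξ⟫_ℂ = ⟪φ x ξ, ξ⟫_ℂ := by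
  have key (y : S.toSubmodule) (hy : adj y = y) : ⟪φ y ξ, ξ⟫_ℂ = ⟪ξ, φ y ξ⟫_ℂ := by
    let one : S.toSubmodule := ⟨1, S.one_mem'⟩
    have hsa : IsSelfAdjoint (y : A) := congrArg Subtype.val hy
    have h1 := hφ.inner_nonneg (y + (‖(y : A)‖ : ℂ) • one) (by
      have := hsa.neg_algebraMap_norm_le_self
      simp only [Submodule.coe_add, Submodule.coe_smul, one]
      rw [neg_le_iff_add_nonneg, Algebra.algebraMap_eq_smul_one] at this
      simpa using this) ξ
    have h2 := hφ.inner_nonneg one (by simp [one]) ξ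
    rw [Complex.nonneg_iff] at h1 h2
    simp only [map_add, map_smul, _root_.add_apply, _root_.smul_apply,
      inner_add_right, inner_smul_right, Complex.add_im, Complex.mul_im, ← h2.2] at h1
    have h3 : (⟪ξ, φ y ξ⟫_ℂ).im = 0 := by simpa using h1.2.symm
    rw [← inner_conj_symm, Complex.conj_eq_iff_im.mpr h3]
  have k1 := key (x + adj x) (Subtype.ext (by simp [add_comm]))
  have k2 := key (Complex.I • (x - adj x)) (Subtype.ext (by
    simp [sub_eq_add_neg, add_comm]))
  simp only [map_add, map_smul, map_sub, _root_.add_apply,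
    _root_.smul_apply, _root_.sub_apply, inner_add_left,
    inner_add_right, inner_smul_left, inner_smul_right, inner_sub_left, inner_sub_right,
    Complex.conj_I] at k1 k2
  have k3 : -(⟪φ x ξ, ξ⟫_ℂ - ⟪φ (adj x) ξ, ξ⟫_ℂ) = ⟪ξ, φ x ξ⟫_ℂ - ⟪ξ, φ (adj x) ξ⟫_ℂ :=
    mul_left_cancel₀ Complex.I_ne_zero (by linear_combination k2)
  linear_combination (-1/2) * k1 + (1/2) * k3

/-- Completely positive maps are self-adjoint. -/
lemma IsCompletelyPositive.map_adj {φ : S.OpMap H} (hφ : IsCompletelyPositive φ)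
    (x : S.toSubmodule) : φ (adj x) = ContinuousLinearMap.adjoint (φ x) := by
  have : (φ (adj x) : H →ₗ[ℂ] H) = (ContinuousLinearMap.adjoint (φ x) : H →L[ℂ] H) := by
    rw [← ext_inner_map]
    intro ξ
    simp only [ContinuousLinearMap.coe_coe, ContinuousLinearMap.adjoint_inner_left]
    rw [← inner_conj_symm, hφ.inner_self_adj, inner_conj_symm]
  exact ContinuousLinearMap.coe_injective this

end OperatorSystem

/-! ### Arveson extension and Stinespring dilation through positive kernels. -/

namespace OperatorSystem

section Kernel

variable {A : Type*} [CStarAlgebra A] [PartialOrder A] [StarOrderedRing A] {X : Type*}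

/-- The quadratic form of a finitely supported `A`-valued kernel on `X`, evaluated at `b : X → A`,
as a linear function of the kernel. -/
noncomputable def kernelForm (b : X → A) : (X × X →₀ A) →ₗ[ℂ] A :=
  Finsupp.lsum ℂ fun p => LinearMap.mulLeftRight ℂ (star (b p.1), b p.2)

@[simp] lemma kernelForm_single (b : X → A) (p : X × X) (a : A) :
    kernelForm b (Finsupp.single p a) = star (b p.1) * a * b p.2 := by
  simp [kernelForm]

lemma kernelForm_apply (b : X → A) (y : X × X →₀ A) :
    kernelForm b y = y.sum fun p a => star (b p.1) * a * b p.2 := by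
  simp [kernelForm, Finsupp.lsum_apply, Finsupp.sum]

/-- The cone of kernels whose quadratic form has positive real part. -/
noncomputable def kernelCone (A : Type*) [CStarAlgebra A] [PartialOrder A] [StarOrderedRing A]
    (X : Type*) : PointedCone ℝ (X × X →₀ A) where
  carrier := {y | ∀ b, 0 ≤ kernelForm b y + star (kernelForm b y)}
  add_mem' {y z} hy hz b := by
    have := add_nonneg (hy b) (hz b)
    rw [map_add, star_add, add_add_add_comm]
    exact this
  zero_mem' b := by simp
  smul_mem' c y hy b := by
    have h : c • y = ((c : ℝ) : ℂ) • y := by ext; simp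
    have := smul_nonneg c.2 (hy b)
    rw [h, map_smul, star_smul]
    simpa using this

/-- Scalar diagonal kernels absorb any single entry: this is the cofinality of the `S`-valued
kernels that the Riesz extension requires. With `r = ‖a‖²`, the cross terms are completed to the
square of `b p.1 + a * b p.2`. -/
lemma exists_single_add_mem_kernelCone (p : X × X) (a : A) : ∃ r : ℂ,
    Finsupp.single (p.1, p.1) 1 + Finsupp.single (p.2, p.2) (r • 1) + Finsupp.single p a ∈
      kernelCone A X := by
  refine ⟨(‖a‖ ^ 2 : ℝ), fun b => ?_⟩
  have h1 : 0 ≤ star (b p.1) * b p.1 := star_mul_self_nonneg _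
  have h2 : 0 ≤ star (b p.1 + a * b p.2) * (b p.1 + a * b p.2) := star_mul_self_nonneg _
  have h3 : 0 ≤ star (b p.2) * b p.2 := star_mul_self_nonneg _
  have h4 : star (a * b p.2) * (a * b p.2) ≤ ‖a‖ ^ 2 • (star (b p.2) * b p.2) := by
    rw [star_mul, ← mul_assoc, mul_assoc _ (star a), sq, ← CStarRing.norm_star_mul_self (x := a)]
    exact CStarAlgebra.star_left_conjugate_le_norm_smul
  have h5 : 0 ≤ ‖a‖ ^ 2 • (star (b p.2) * b p.2) := smul_nonneg (by positivity) h3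
  simp only [map_add, kernelForm_single, star_add, star_mul, star_star, star_smul,
    mul_smul_comm, smul_mul_assoc, mul_one, Complex.star_def, Complex.conj_ofReal] at *
  rw [Complex.coe_smul]
  have h6 := add_nonneg h1 (add_nonneg h2 (add_nonneg (sub_nonneg.mpr h4) h5))
  refine h6.trans_eq ?_
  simp only [add_mul, mul_add, mul_assoc]
  abel

/-- A linear functional on finitely supported kernels that is positive on positive kernels. -/
structure KernelFunctional (A : Type*) [CStarAlgebra A] [PartialOrder A] [StarOrderedRing A]
    (X : Type*) where
  /-- The underlying linear functional. -/
  toLin : (X × X →₀ A) →ₗ[ℂ] ℂ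
  nonneg : ∀ y, (∀ b, 0 ≤ kernelForm b y) → 0 ≤ toLin y
  map_star : ∀ y z, (∀ b, kernelForm b z = star (kernelForm b y)) → toLin z = star (toLin y)

/-- Complexification of a real functional that is positive on the cone of kernels. -/
lemma exists_kernelFunctional (g : (X × X →₀ A) →ₗ[ℝ] ℝ) (hg : ∀ y ∈ kernelCone A X, 0 ≤ g y) :
    ∃ G : KernelFunctional A X, ∀ y, G.toLin y = g y - Complex.I * g (Complex.I • y) := by
  let G : (X × X →₀ A) →ₗ[ℂ] ℂ := Module.Dual.extendRCLike (𝕜 := ℂ) g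
  have hG (y) : G y = g y - Complex.I * g (Complex.I • y) := by
    simp [G, Module.Dual.extendRCLike_apply]
  -- A kernel with skew form lies in the cone together with its negative, so `g` kills it. Hence a
  -- cone that only sees real parts still yields a functional compatible with adjoints.
  have hskew (y) (hy : ∀ b, kernelForm b y + star (kernelForm b y) = 0) : g y = 0 := by
    have h1 := hg y fun b => (hy b).ge
    have h2 := hg (-y) fun b => by
      rw [map_neg, star_neg, ← neg_add, hy b, neg_zero]
    rw [map_neg] at h2
    linarith
  refine ⟨⟨G, fun y hy => ?_, fun y z hyz => ?_⟩, hG⟩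
  · have h1 : g (Complex.I • y) = 0 := hskew _ fun b => by
      rw [map_smul, star_smul, (hy b).isSelfAdjoint.star_eq]
      simp
    rw [hG, h1]
    simpa using hg y fun b => add_nonneg (hy b) (star_nonneg_iff.mpr (hy b))
  · have h1 : g (y - z) = 0 := hskew _ fun b => by
      rw [map_sub, hyz b]
      simp
    have h2 : g (Complex.I • (y + z)) = 0 := hskew _ fun b => by
      rw [map_smul, map_add, hyz b]
      simp only [star_smul, star_add, star_star, Complex.star_def, Complex.conj_I, neg_smul,
        smul_add]
      abel
    rw [map_sub, sub_eq_zero] at h1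
    rw [smul_add, map_add, add_eq_zero_iff_eq_neg] at h2
    simp [hG, h1, h2, sub_eq_add_neg]

namespace KernelFunctional

variable (G : KernelFunctional A X)

/-- Reduces identities between values of `G` to algebra in `A`; the sesquilinearity of the inner
product and the adjoint relation are checked this way. -/
lemma congr {y z : X × X →₀ A} (h : ∀ b, kernelForm b y = kernelForm b z) :
    G.toLin y = G.toLin z := by
  refine le_antisymm ?_ ?_
  · rw [← sub_nonneg, ← map_sub]
    exact G.nonneg _ fun b => by rw [map_sub, h b, sub_self]
  · rw [← sub_nonneg, ← map_sub]
    exact G.nonneg _ fun b => by rw [map_sub, h b, sub_self]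

lemma mono {y z : X × X →₀ A} (h : ∀ b, kernelForm b y ≤ kernelForm b z) :
    G.toLin y ≤ G.toLin z := by
  rw [← sub_nonneg, ← map_sub]
  exact G.nonneg _ fun b => by rw [map_sub]; exact sub_nonneg.mpr (h b)

/-- Evaluation of a finitely supported function at `b : X → A`. -/
noncomputable def eval (b : X → A) : (X →₀ A) →ₗ[ℂ] A :=
  Finsupp.lsum ℂ fun x => LinearMap.mulRight ℂ (b x)

/-- The kernel `(x, y) ↦ (c x)⋆ (d y)`. -/
noncomputable def pair (c d : X →₀ A) : X × X →₀ A :=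
  c.sum fun x a => d.sum fun y a' => Finsupp.single (x, y) (star a * a')

lemma kernelForm_pair (b : X → A) (c d : X →₀ A) :
    kernelForm b (pair c d) = star (eval b c) * eval b d := by
  simp only [pair, eval, Finsupp.lsum_apply, Finsupp.sum, map_sum, kernelForm_single,
    LinearMap.mulRight_apply, star_sum, star_mul, Finset.sum_mul_sum, mul_assoc]

lemma pair_single (x y : X) (a a' : A) :
    pair (Finsupp.single x a) (Finsupp.single y a') = Finsupp.single (x, y) (star a * a') := by
  simp [pair]

/-- Left multiplication on finitely supported functions. -/
noncomputable def leftMul (a : A) : (X →₀ A) →ₗ[ℂ] (X →₀ A) :=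
  Finsupp.mapRange.linearMap (LinearMap.mulLeft ℂ a)

lemma leftMul_single (a a' : A) (x : X) :
    leftMul a (Finsupp.single x a') = Finsupp.single x (a * a') := by
  simp [leftMul]

@[simp] lemma eval_leftMul (b : X → A) (a : A) (c : X →₀ A) :
    eval b (leftMul a c) = a * eval b c := by
  induction c using Finsupp.induction_linear with
  | zero => simp
  | add c d hc hd => simp only [map_add, hc, hd, mul_add]
  | single x a' =>
    simp only [leftMul_single, eval, Finsupp.lsum_single, LinearMap.mulRight_apply, mul_assoc]

set_option linter.unusedVariables false in
/-- The pre-Hilbert space of a positive functional on kernels. -/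
@[nolint unusedArguments]
def PreGNS (G : KernelFunctional A X) := X →₀ A

noncomputable instance : AddCommGroup G.PreGNS := inferInstanceAs (AddCommGroup (X →₀ A))
noncomputable instance : Module ℂ G.PreGNS := inferInstanceAs (Module ℂ (X →₀ A))

/-- The quotient map onto the pre-Hilbert space, as a linear equivalence. -/
noncomputable def toPreGNS : (X →₀ A) ≃ₗ[ℂ] G.PreGNS := LinearEquiv.refl ℂ _

/-- The semi-inner product defined by a positive functional on kernels. -/
noncomputable abbrev preInnerProductCore : PreInnerProductSpace.Core ℂ G.PreGNS where
  inner c d := G.toLin (pair (G.toPreGNS.symm c) (G.toPreGNS.symm d))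
  conj_inner_symm c d := by
    rw [starRingEnd_apply]
    exact (G.map_star _ _ fun b => by simp [kernelForm_pair]).symm
  re_inner_nonneg c := RCLike.nonneg_iff.mp
    (G.nonneg _ fun b => by rw [kernelForm_pair]; exact star_mul_self_nonneg _) |>.1
  add_left c d e := by
    rw [← map_add]
    exact G.congr fun b => by simp [kernelForm_pair, add_mul]
  smul_left c d r := by
    rw [← smul_eq_mul, ← map_smul]
    exact G.congr fun b => by simp [kernelForm_pair]

noncomputable instance : SeminormedAddCommGroup G.PreGNS :=
  InnerProductSpace.Core.toSeminormedAddCommGroup (c := G.preInnerProductCore)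
noncomputable instance : InnerProductSpace ℂ G.PreGNS :=
  InnerProductSpace.ofCore G.preInnerProductCore

lemma inner_toPreGNS (c d : X →₀ A) :
    ⟪G.toPreGNS c, G.toPreGNS d⟫_ℂ = G.toLin (pair c d) := rfl

/-- Left multiplication on the pre-Hilbert space. -/
noncomputable def leftMulPreGNS (a : A) : G.PreGNS →L[ℂ] G.PreGNS :=
  (G.toPreGNS.toLinearMap ∘ₗ leftMul a ∘ₗ G.toPreGNS.symm.toLinearMap).mkContinuous ‖a‖ fun x => by
    obtain ⟨c, rfl⟩ := G.toPreGNS.surjective x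
    have h : G.toLin (pair (leftMul a c) (leftMul a c)) ≤
        ((‖a‖ ^ 2 : ℝ) : ℂ) • G.toLin (pair c c) := by
      rw [← map_smul]
      refine G.mono fun b => ?_
      rw [map_smul, kernelForm_pair, kernelForm_pair, eval_leftMul, star_mul, ← mul_assoc,
        mul_assoc _ (star a), Complex.coe_smul, sq, ← CStarRing.norm_star_mul_self (x := a)]
      exact CStarAlgebra.star_left_conjugate_le_norm_smul
    rw [← inner_toPreGNS, ← inner_toPreGNS, inner_self_eq_norm_sq_to_K,
      inner_self_eq_norm_sq_to_K, smul_eq_mul] at h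
    rw [← sq_le_sq₀ (by positivity) (by positivity), mul_pow]
    simp only [← RCLike.ofReal_pow] at h
    refine Complex.real_le_real.mp (h.trans_eq ?_)
    rw [Complex.ofReal_mul]
    rfl

lemma leftMulPreGNS_apply (a : A) (c : X →₀ A) :
    G.leftMulPreGNS a (G.toPreGNS c) = G.toPreGNS (leftMul a c) := rfl

open UniformSpace

/-- The representation of `A` on the completion of the pre-Hilbert space, by left multiplication. -/
noncomputable def gnsStarAlgHom :
    A →⋆ₐ[ℂ] (Completion G.PreGNS →L[ℂ] Completion G.PreGNS) where
  toFun a := (G.leftMulPreGNS a).completion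
  map_one' := by
    ext c
    induction c using Completion.induction_on with
    | hp => apply isClosed_eq <;> fun_prop
    | ih c =>
      obtain ⟨c, rfl⟩ := G.toPreGNS.surjective c
      simp [leftMulPreGNS_apply, leftMul]
  map_mul' a a' := by
    ext c
    induction c using Completion.induction_on with
    | hp => apply isClosed_eq <;> fun_prop
    | ih c =>
      obtain ⟨c, rfl⟩ := G.toPreGNS.surjective c
      have : leftMul (a * a') c = leftMul a (leftMul a' c) := by
        ext x; simp [leftMul]
      simp [leftMulPreGNS_apply, this]
  map_zero' := by
    ext c
    induction c using Completion.induction_on with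
    | hp => apply isClosed_eq <;> fun_prop
    | ih c =>
      obtain ⟨c, rfl⟩ := G.toPreGNS.surjective c
      have : leftMul (0 : A) c = 0 := by
        ext x; simp [leftMul]
      simpa [leftMulPreGNS_apply, this] using Completion.coe_zero
  map_add' a a' := by
    ext c
    induction c using Completion.induction_on with
    | hp => apply isClosed_eq <;> fun_prop
    | ih c =>
      obtain ⟨c, rfl⟩ := G.toPreGNS.surjective c
      have : leftMul (a + a') c = leftMul a c + leftMul a' c := by
        ext x; simp [leftMul, add_mul]
      simp [leftMulPreGNS_apply, this, Completion.coe_add]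
  commutes' r := by
    ext c
    induction c using Completion.induction_on with
    | hp => apply isClosed_eq <;> fun_prop
    | ih c =>
      obtain ⟨c, rfl⟩ := G.toPreGNS.surjective c
      have : leftMul (algebraMap ℂ A r) c = r • c := by
        ext x; simp [leftMul, Algebra.algebraMap_eq_smul_one]
      rw [ContinuousLinearMap.completion_apply_coe, leftMulPreGNS_apply, this]
      simp [Algebra.algebraMap_eq_smul_one]
  map_star' a := by
    refine (ContinuousLinearMap.eq_adjoint_iff _ _).mpr fun c d => ?_
    induction c, d using Completion.induction_on₂ with
    | hp => apply isClosed_eq <;> fun_prop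
    | ih c d =>
      obtain ⟨c, rfl⟩ := G.toPreGNS.surjective c
      obtain ⟨d, rfl⟩ := G.toPreGNS.surjective d
      simp only [ContinuousLinearMap.completion_apply_coe, Completion.inner_coe,
        leftMulPreGNS_apply, inner_toPreGNS]
      exact G.congr fun b => by simp [kernelForm_pair, mul_assoc]

/-- The vector of the completion attached to a point of `X`. -/
noncomputable def vec (x : X) : Completion G.PreGNS := G.toPreGNS (Finsupp.single x 1)

lemma inner_vec (x y : X) (a : A) :
    ⟪G.vec x, G.gnsStarAlgHom a (G.vec y)⟫_ℂ = G.toLin (Finsupp.single (x, y) a) := by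
  have : G.gnsStarAlgHom a (G.vec y) = (G.leftMulPreGNS a).completion (G.vec y) := rfl
  rw [this, vec, vec, ContinuousLinearMap.completion_apply_coe, Completion.inner_coe,
    leftMulPreGNS_apply, inner_toPreGNS, leftMul_single, pair_single]
  simp

end KernelFunctional
end Kernel

lemma sum_eq_sum_sum_of_support_subset {X M E : Type*} [Zero M] [AddCommMonoid E]
    {y : X × X →₀ M} {s : Finset X} (hs : y.support ⊆ s ×ˢ s) (k : X × X → M → E)
    (hk : ∀ p, k p 0 = 0) : y.sum k = ∑ ξ : s, ∑ η : s, k (ξ, η) (y (ξ, η)) := by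
  rw [Finsupp.sum_of_support_subset _ hs _ fun p _ => hk p, Finset.sum_product,
    ← Finset.sum_coe_sort s]
  refine Finset.sum_congr rfl fun ξ _ => ?_
  rw [← Finset.sum_coe_sort s]

/-- A map between inner product spaces that preserves inner products is a linear isometry. -/
lemma exists_linearIsometry_of_inner {E F : Type*} [NormedAddCommGroup E] [InnerProductSpace ℂ E]
    [NormedAddCommGroup F] [InnerProductSpace ℂ F] (f : E → F)
    (hf : ∀ x y, ⟪f x, f y⟫_ℂ = ⟪x, y⟫_ℂ) : ∃ V : E →ₗᵢ[ℂ] F, ∀ x, V x = f x := by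
  have hadd (x y) : f (x + y) = f x + f y := by
    rw [← sub_eq_zero, ← inner_self_eq_zero (𝕜 := ℂ)]
    simp only [inner_sub_left, inner_add_left, inner_sub_right, inner_add_right, hf]
    ring
  have hsmul (c : ℂ) (x) : f (c • x) = c • f x := by
    rw [← sub_eq_zero, ← inner_self_eq_zero (𝕜 := ℂ)]
    simp only [inner_sub_left, inner_smul_left, inner_sub_right, inner_smul_right, hf]
    ring
  exact ⟨LinearMap.isometryOfInner ⟨⟨f, hadd⟩, hsmul⟩ hf, fun _ => rfl⟩

variable {A : Type u} [CStarAlgebra A] [PartialOrder A] [StarOrderedRing A] {S : OperatorSystem A}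
  {H : Type v} [NormedAddCommGroup H] [InnerProductSpace ℂ H] [CompleteSpace H]

/-- A completely positive map on an operator system extends to a positive functional on
kernels. -/
lemma IsCompletelyPositive.exists_kernelFunctional {φ : S.OpMap H} (hφ : IsCompletelyPositive φ) :
    ∃ G : KernelFunctional A H, ∀ (ξ η : H) (x : S.toSubmodule),
      G.toLin (Finsupp.single (ξ, η) (x : A)) = ⟪ξ, φ x η⟫_ℂ := by
  classical
  -- Only the linearity of `Φ` matters: it defines `F` on all kernels, and positivity is used on
  -- `S`-valued kernels alone.
  obtain ⟨Φ, hΦ⟩ := LinearMap.exists_extend φ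
  replace hΦ (x : S.toSubmodule) : Φ x = φ x := LinearMap.congr_fun hΦ x
  let F : (H × H →₀ A) →ₗ[ℂ] ℂ := Finsupp.lsum ℂ fun p =>
    (innerₛₗ ℂ p.1) ∘ₗ (ContinuousLinearMap.apply ℂ H p.2 : (H →L[ℂ] H) →L[ℂ] H).toLinearMap ∘ₗ Φ
  have hF (y) : F y = y.sum fun p a => ⟪p.1, Φ a p.2⟫_ℂ := by
    simp [F, Finsupp.lsum_apply, Finsupp.sum]
  let dom : Submodule ℝ (H × H →₀ A) :=
    { carrier := {y | ∀ p, y p ∈ S.toSubmodule}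
      add_mem' := fun hy hz p => S.toSubmodule.add_mem (hy p) (hz p)
      zero_mem' := fun p => S.toSubmodule.zero_mem
      smul_mem' := fun r y hy p => by
        have : (r • y) p = (r : ℂ) • y p := by simp
        rw [this]
        exact S.toSubmodule.smul_mem _ (hy p) }
  have hdom {p : H × H} {a : A} (ha : a ∈ S.toSubmodule) : Finsupp.single p a ∈ dom := fun q => by
    rw [Finsupp.single_apply]
    split_ifs
    exacts [ha, S.toSubmodule.zero_mem]
  let f : (H × H →₀ A) →ₗ.[ℝ] ℝ :=
    ⟨dom, (Complex.reLm ∘ₗ F.restrictScalars ℝ) ∘ₗ dom.subtype⟩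
  have hnonneg (y : f.domain) (hpos : (y : H × H →₀ A) ∈ kernelCone A H) : 0 ≤ f y := by
    obtain ⟨y, hy⟩ := y
    change 0 ≤ (F y).re
    let s : Finset H := y.support.image Prod.fst ∪ y.support.image Prod.snd
    have hs : y.support ⊆ s ×ˢ s := fun p hp => by
      simp only [s, Finset.mem_product, Finset.mem_union]
      exact ⟨Or.inl (Finset.mem_image_of_mem _ hp), Or.inr (Finset.mem_image_of_mem _ hp)⟩
    let Y (ξ η : s) : S.toSubmodule := ⟨y (ξ, η), hy _⟩
    -- Membership in the cone controls only the Hermitian part of `y`; complete positivity applied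
    -- to that part gives `2 Re F(y) ≥ 0`.
    have h := hφ.sum_inner_nonneg (fun ξ η => Y ξ η + adj (Y η ξ)) (fun b => by
      let b' : H → A := fun ξ => if h : ξ ∈ s then b ⟨ξ, h⟩ else 0
      have hb' (ξ : s) : b' ξ = b ξ := by simp [b']
      have := hpos b'
      rw [kernelForm_apply, sum_eq_sum_sum_of_support_subset hs _ (by simp)] at this
      refine this.trans_eq ?_
      simp only [hb', star_sum, star_mul, star_star, Submodule.coe_add, coe_adj, mul_add, add_mul,
        Finset.sum_add_distrib, Y]
      congr 1
      rw [Finset.sum_comm]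
      simp only [mul_assoc]) (fun ξ => (ξ : H))
    have h2 : F y = ∑ ξ : s, ∑ η : s, ⟪(ξ : H), φ (Y ξ η) η⟫_ℂ := by
      rw [hF, sum_eq_sum_sum_of_support_subset hs _ (by simp)]
      refine Finset.sum_congr rfl fun ξ _ => Finset.sum_congr rfl fun η _ => ?_
      rw [← hΦ]
    have h3 : ∑ ξ : s, ∑ η : s, ⟪(ξ : H), φ (Y ξ η + adj (Y η ξ)) η⟫_ℂ = F y + star (F y) := by
      rw [h2, star_sum]
      simp only [map_add, _root_.add_apply, inner_add_right, Finset.sum_add_distrib, star_sum,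
        hφ.map_adj, ContinuousLinearMap.adjoint_inner_right]
      congr 1
      rw [Finset.sum_comm]
      refine Finset.sum_congr rfl fun ξ _ => Finset.sum_congr rfl fun η _ => ?_
      rw [← inner_conj_symm, starRingEnd_apply]
    rw [h3, Complex.nonneg_iff] at h
    have := h.1
    simp at this
    linarith
  have hdense (y : H × H →₀ A) : ∃ x : f.domain, (x : H × H →₀ A) + y ∈ kernelCone A H := by
    induction y using Finsupp.induction_linear with
    | zero => exact ⟨0, by simp [(kernelCone A H).zero_mem]⟩
    | add y z hy hz =>
      obtain ⟨y', hy'⟩ := hy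
      obtain ⟨z', hz'⟩ := hz
      refine ⟨y' + z', ?_⟩
      have := (kernelCone A H).add_mem hy' hz'
      rwa [add_add_add_comm] at this
    | single p a =>
      obtain ⟨r, hr⟩ := exists_single_add_mem_kernelCone p a
      exact ⟨⟨_, dom.add_mem (hdom S.one_mem') (hdom (S.toSubmodule.smul_mem r S.one_mem'))⟩, hr⟩
  obtain ⟨g, hgf, hg⟩ := riesz_extension (kernelCone A H) f hnonneg hdense
  obtain ⟨G, hG⟩ := OperatorSystem.exists_kernelFunctional g hg
  refine ⟨G, fun ξ η x => ?_⟩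
  have h (x : S.toSubmodule) : g (Finsupp.single (ξ, η) (x : A)) = (⟪ξ, φ x η⟫_ℂ).re := by
    refine (hgf ⟨_, hdom x.2⟩).trans ?_
    change (F _).re = _
    rw [hF]
    simp [hΦ]
  have h2 := h (Complex.I • x)
  rw [hG, h, Finsupp.smul_single, ← Submodule.coe_smul, h2]
  apply Complex.ext <;> simp

/-- Every unital completely positive map on an operator system dilates to a representation of the
C⋆-algebra generated by it (the theorems of Arveson and Stinespring combined). -/
theorem IsUCP.exists_representation {φ : S.OpMap H} (hφ : IsUCP φ) :
    ∃ (K : Type (max u v)) (_ : NormedAddCommGroup K) (_ : InnerProductSpace ℂ K)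
      (_ : CompleteSpace K) (π : A →⋆ₐ[ℂ] (K →L[ℂ] K)) (V : H →ₗᵢ[ℂ] K),
      ∀ (x : S.toSubmodule) (ξ η : H), ⟪V ξ, π (x : A) (V η)⟫_ℂ = ⟪ξ, φ x η⟫_ℂ := by
  obtain ⟨G, hG⟩ := hφ.completelyPositive.exists_kernelFunctional
  -- `H` indexes the kernels as a bare set; unitality of `φ` makes `G.vec` preserve inner products,
  -- and linearity follows from that.
  obtain ⟨V, hV⟩ := exists_linearIsometry_of_inner G.vec fun ξ η => by
    have := G.inner_vec ξ η 1
    rw [hG ξ η ⟨1, S.one_mem'⟩, hφ.map_one] at this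
    simpa using this
  exact ⟨_, _, _, inferInstance, G.gnsStarAlgHom, V, fun x ξ η => by
    rw [hV, hV, G.inner_vec, hG]⟩

end OperatorSystem

/-! ### Dilations as compressions by isometries. -/

namespace OperatorSystem

variable {A : Type u} [CStarAlgebra A] [PartialOrder A] [StarOrderedRing A] {S : OperatorSystem A}
  {H : Type*} [NormedAddCommGroup H] [InnerProductSpace ℂ H] [CompleteSpace H]
  {K : Type*} [NormedAddCommGroup K] [InnerProductSpace ℂ K] [CompleteSpace K]
  {L : Type*} [NormedAddCommGroup L] [InnerProductSpace ℂ L] [CompleteSpace L]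

open ContinuousLinearMap (adjoint)

/-- The compression `T ↦ V* T V` of operators by an isometry. -/
noncomputable def compression (V : H →ₗᵢ[ℂ] K) : (K →L[ℂ] K) →ₗ[ℂ] (H →L[ℂ] H) where
  toFun T := adjoint V.toContinuousLinearMap ∘L T ∘L V.toContinuousLinearMap
  map_add' T T' := by ext; simp
  map_smul' c T := by ext; simp

lemma inner_compression (V : H →ₗᵢ[ℂ] K) (T : K →L[ℂ] K) (ξ η : H) :
    ⟪ξ, compression V T η⟫_ℂ = ⟪V ξ, T (V η)⟫_ℂ := by
  simp [compression, ContinuousLinearMap.adjoint_inner_right]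

lemma adjoint_apply_self (V : H →ₗᵢ[ℂ] K) (ξ : H) : adjoint V.toContinuousLinearMap (V ξ) = ξ :=
  ext_inner_left ℂ fun η => by simp [ContinuousLinearMap.adjoint_inner_right]

lemma norm_adjoint_apply_le (V : H →ₗᵢ[ℂ] K) (k : K) :
    ‖adjoint V.toContinuousLinearMap k‖ ≤ ‖k‖ := by
  refine (ContinuousLinearMap.le_opNorm _ _).trans ?_
  rw [LinearIsometryEquiv.norm_map]
  exact mul_le_of_le_one_left (norm_nonneg _) V.norm_toContinuousLinearMap_le

/-- Pythagoras for the projection `V V*`: a vector that loses no norm under it lies in the range of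
`V`. -/
lemma apply_adjoint_of_norm_eq (V : H →ₗᵢ[ℂ] K) {k : K}
    (h : ‖k‖ ≤ ‖adjoint V.toContinuousLinearMap k‖) : V (adjoint V.toContinuousLinearMap k) = k := by
  set p := adjoint V.toContinuousLinearMap k with hp
  have h1 : ⟪k, V p⟫_ℂ = ⟪p, p⟫_ℂ := by
    rw [hp, ContinuousLinearMap.adjoint_inner_left]
    rfl
  have h2 := norm_sub_sq (𝕜 := ℂ) (V p) k
  rw [← inner_re_symm, h1, V.norm_map, inner_self_eq_norm_sq] at h2
  have h3 : ‖V p - k‖ ^ 2 ≤ 0 := by nlinarith [norm_nonneg k, norm_nonneg p]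
  rw [← sub_eq_zero, ← norm_eq_zero]
  exact pow_eq_zero_iff two_ne_zero |>.mp (le_antisymm h3 (sq_nonneg _))

lemma isDilation_iff {φ : S.OpMap H} {V : H →ₗᵢ[ℂ] K} {ψ : S.OpMap K} :
    IsDilation φ V ψ ↔ ∀ x ξ η, ⟪V ξ, ψ x (V η)⟫_ℂ = ⟪ξ, φ x η⟫_ℂ := by
  refine forall_congr' fun x => ⟨fun h ξ η => ?_, fun h => ?_⟩
  · rw [h, ← inner_compression]
    rfl
  · ext η
    refine ext_inner_left ℂ fun ξ => ?_
    rw [← h, ← inner_compression]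
    rfl

lemma IsDilation.inner_eq {φ : S.OpMap H} {V : H →ₗᵢ[ℂ] K} {ψ : S.OpMap K}
    (h : IsDilation φ V ψ) (x ξ η) : ⟪V ξ, ψ x (V η)⟫_ℂ = ⟪ξ, φ x η⟫_ℂ :=
  isDilation_iff.mp h x ξ η

lemma IsDilation.apply_eq {φ : S.OpMap H} {V : H →ₗᵢ[ℂ] K} {ψ : S.OpMap K}
    (h : IsDilation φ V ψ) (x ξ) : φ x ξ = adjoint V.toContinuousLinearMap (ψ x (V ξ)) := by
  rw [h x]
  rfl

lemma IsDilation.trans {φ : S.OpMap H} {V : H →ₗᵢ[ℂ] K} {ψ : S.OpMap K} {W : K →ₗᵢ[ℂ] L}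
    {χ : S.OpMap L} (h : IsDilation φ V ψ) (h' : IsDilation ψ W χ) :
    IsDilation φ (W.comp V) χ :=
  isDilation_iff.mpr fun x ξ η => by
    simp [h'.inner_eq, h.inner_eq]

lemma IsDilation.refl (φ : S.OpMap H) : IsDilation φ LinearIsometry.id φ :=
  isDilation_iff.mpr fun _ _ _ => rfl

lemma IsDilation.norm_le {φ : S.OpMap H} {V : H →ₗᵢ[ℂ] K} {ψ : S.OpMap K}
    (h : IsDilation φ V ψ) (x ξ) : ‖φ x ξ‖ ≤ ‖ψ x (V ξ)‖ := by
  rw [h.apply_eq]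
  exact norm_adjoint_apply_le _ _

lemma IsDilation.apply_of_norm_le {φ : S.OpMap H} {V : H →ₗᵢ[ℂ] K} {ψ : S.OpMap K}
    (h : IsDilation φ V ψ) {x ξ} (hle : ‖ψ x (V ξ)‖ ≤ ‖φ x ξ‖) : ψ x (V ξ) = V (φ x ξ) := by
  rw [h.apply_eq] at hle ⊢
  exact (apply_adjoint_of_norm_eq V hle).symm

/-- The compression of a map on an operator system by an isometry. -/
noncomputable def compress (V : H →ₗᵢ[ℂ] K) (ψ : S.OpMap K) : S.OpMap H := compression V ∘ₗ ψ

lemma isDilation_compress (V : H →ₗᵢ[ℂ] K) (ψ : S.OpMap K) : IsDilation (compress V ψ) V ψ :=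
  fun _ => rfl

lemma IsDilation.isCompletelyPositive {φ : S.OpMap H} {V : H →ₗᵢ[ℂ] K} {ψ : S.OpMap K}
    (h : IsDilation φ V ψ) (hψ : IsCompletelyPositive ψ) : IsCompletelyPositive φ := by
  refine isCompletelyPositive_iff.mpr fun n M hM ξ => ?_
  simpa only [h.inner_eq] using isCompletelyPositive_iff.mp hψ n M hM fun i => V (ξ i)

lemma IsDilation.isUCP {φ : S.OpMap H} {V : H →ₗᵢ[ℂ] K} {ψ : S.OpMap K}
    (h : IsDilation φ V ψ) (hψ : IsUCP ψ) : IsUCP φ := by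
  refine ⟨?_, h.isCompletelyPositive hψ.completelyPositive⟩
  ext η
  refine ext_inner_left ℂ fun ξ => ?_
  rw [← h.inner_eq, hψ.map_one]
  simp

/-- The restriction of a representation to the operator system. -/
noncomputable def ofRep (S : OperatorSystem A) (π : A →⋆ₐ[ℂ] (K →L[ℂ] K)) : S.OpMap K :=
  π.toAlgHom.toLinearMap ∘ₗ S.toSubmodule.subtype

@[simp] lemma ofRep_apply (π : A →⋆ₐ[ℂ] (K →L[ℂ] K)) (x : S.toSubmodule) :
    ofRep S π x = π (x : A) := rfl

lemma isUCP_ofRep (π : A →⋆ₐ[ℂ] (K →L[ℂ] K)) : IsUCP (ofRep S π) := by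
  refine ⟨by simp, fun n M hM => ?_⟩
  exact CompletelyPositiveMapClass.map_cstarMatrix_nonneg' π n _ hM

/-- The completely positive map `a ↦ V* π(a) V`. -/
noncomputable def compressRep (π : A →⋆ₐ[ℂ] (K →L[ℂ] K)) (V : H →ₗᵢ[ℂ] K) :
    A →CP (H →L[ℂ] H) where
  toLinearMap := compression V ∘ₗ π.toAlgHom.toLinearMap
  map_cstarMatrix_nonneg' n M hM := by
    rw [CStarMatrix.nonneg_iff_inner]
    intro ξ
    have h0 : 0 ≤ M.map π := CompletelyPositiveMapClass.map_cstarMatrix_nonneg' π n M hM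
    have h := CStarMatrix.nonneg_iff_inner.mp h0 fun i => V (ξ i)
    refine h.trans_eq (Finset.sum_congr rfl fun i _ => Finset.sum_congr rfl fun j _ => ?_)
    exact (inner_compression V (π (M i j)) (ξ i) (ξ j)).symm

lemma compressRep_apply (π : A →⋆ₐ[ℂ] (K →L[ℂ] K)) (V : H →ₗᵢ[ℂ] K) (a : A) :
    compressRep π V a = compression V (π a) := rfl

/-- Unital completely positive maps are contractive. -/
lemma IsUCP.norm_apply_le {φ : S.OpMap H} (hφ : IsUCP φ) (x : S.toSubmodule) (ξ : H) :
    ‖φ x ξ‖ ≤ ‖x‖ * ‖ξ‖ := by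
  obtain ⟨K, _, _, _, π, V, h⟩ := hφ.exists_representation
  have h' : IsDilation φ V (ofRep S π) := isDilation_iff.mpr h
  calc ‖φ x ξ‖ ≤ ‖π (x : A) (V ξ)‖ := h'.norm_le x ξ
    _ ≤ ‖π (x : A)‖ * ‖V ξ‖ := ContinuousLinearMap.le_opNorm _ _
    _ ≤ ‖x‖ * ‖ξ‖ := by
      rw [V.norm_map]
      gcongr
      exact NonUnitalStarAlgHom.norm_apply_le π _

lemma IsUCP.opNorm_le {φ : S.OpMap H} (hφ : IsUCP φ) (x : S.toSubmodule) : ‖φ x‖ ≤ ‖x‖ :=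
  ContinuousLinearMap.opNorm_le_bound _ (norm_nonneg _) (hφ.norm_apply_le x)

/-- A separable Hilbert space has an isometric copy in every universe. -/
lemma exists_linearIsometryEquiv_of_separable (K : Type w) [NormedAddCommGroup K]
    [InnerProductSpace ℂ K] [CompleteSpace K] [TopologicalSpace.SeparableSpace K] :
    ∃ (L : Type v) (_ : NormedAddCommGroup L) (_ : InnerProductSpace ℂ L) (_ : CompleteSpace L),
      TopologicalSpace.SeparableSpace L ∧ Nonempty (L ≃ₗᵢ[ℂ] K) := by
  obtain ⟨s, b, hb⟩ := exists_hilbertBasis ℂ K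
  have hs : Countable s := by
    have hor := b.orthonormal
    refine Pairwise.countable_of_isOpen_disjoint (s := fun i : s => Metric.ball (b i) (1 / 2))
      (fun i j hij => ?_) (fun _ => Metric.isOpen_ball) (fun i => ⟨b i, by simp⟩)
    refine Metric.ball_disjoint_ball ?_
    -- Distinct basis vectors are `√2 > 1` apart, so the balls of radius `1/2` are disjoint.
    have h1 : dist (b i) (b j) ^ 2 = 2 := by
      rw [dist_eq_norm, norm_sub_sq (𝕜 := ℂ), hor.1, hor.1, hor.2 hij]
      norm_num
    nlinarith [dist_nonneg (x := b i) (y := b j)]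
  let e := (equivShrink.{v} s).symm
  let e' := (HilbertBasis.mk (b.orthonormal.comp e e.injective) (by
    rw [e.surjective.range_comp, b.dense_span])).repr.symm
  exact ⟨_, _, _, inferInstance, e'.symm.surjective.denseRange.separableSpace
    e'.symm.continuous, ⟨e'⟩⟩

end OperatorSystem

/-! ### Limits of sequences of Hilbert spaces and of dilations. -/

namespace OperatorSystem

open ContinuousLinearMap (adjoint)
open Filter Topology

section HilbertLimit

variable (H : ℕ → Type v) [∀ n, NormedAddCommGroup (H n)] [∀ n, InnerProductSpace ℂ (H n)]
  [∀ n, CompleteSpace (H n)] (V : ∀ n, H n →ₗᵢ[ℂ] H (n + 1))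

/-- An isometry of `H n` into the Hilbert sum, supported on the coordinates up to `n`, extends to
such an isometry of `H (n + 1)`. -/
lemma exists_extension_to_hilbertSum (n : ℕ) (J : H n →ₗᵢ[ℂ] lp H 2)
    (hJ : ∀ ξ k, n < k → J ξ k = 0) :
    ∃ J' : H (n + 1) →ₗᵢ[ℂ] lp H 2,
      (∀ ξ k, n + 1 < k → J' ξ k = 0) ∧ ∀ ξ, J' (V n ξ) = J ξ := by
  let P := adjoint (V n).toContinuousLinearMap
  have hP (x : H n) (y : H (n + 1)) : ⟪V n x, y⟫_ℂ = ⟪x, P y⟫_ℂ :=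
    (ContinuousLinearMap.adjoint_inner_right (V n).toContinuousLinearMap x y).symm
  have hP' (x : H n) (y : H (n + 1)) : ⟪y, V n x⟫_ℂ = ⟪P y, x⟫_ℂ :=
    (ContinuousLinearMap.adjoint_inner_left (V n).toContinuousLinearMap x y).symm
  have hPV (x : H n) : P (V n x) = x := adjoint_apply_self (V n) x
  -- The range of `V n` is mapped by `J`; its orthogonal complement goes to coordinate `n + 1`,
  -- where `J` vanishes.
  let f (ξ : H (n + 1)) : lp H 2 := J (P ξ) + lp.single 2 (n + 1) (ξ - V n (P ξ))
  obtain ⟨J', hJ'⟩ := exists_linearIsometry_of_inner f fun x y => by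
    simp only [f, inner_add_left, inner_add_right, lp.inner_single_left, lp.inner_single_right,
      hJ _ _ (Nat.lt_succ_self n), J.inner_map_map, lp.single_apply_self]
    simp only [inner_sub_left, inner_sub_right, hP, hP', map_sub, map_zero, hPV, sub_self, inner_zero_left,
      inner_zero_right]
    ring
  refine ⟨J', fun ξ k hk => ?_, fun ξ => ?_⟩
  · rw [hJ']
    simp only [f, lp.coeFn_add, Pi.add_apply]
    rw [hJ _ _ (by omega), lp.single_apply_ne _ _ _ (by omega), add_zero]
  · rw [hJ']
    simp only [f, hPV, sub_self]
    simp

/-- The inductive limit of a sequence of Hilbert spaces along isometries. -/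
lemma exists_hilbert_limit :
    ∃ (K : Type v) (_ : NormedAddCommGroup K) (_ : InnerProductSpace ℂ K) (_ : CompleteSpace K)
      (J : ∀ n, H n →ₗᵢ[ℂ] K), (∀ n ξ, J (n + 1) (V n ξ) = J n ξ) ∧
      Dense (⋃ n, Set.range (J n)) := by
  obtain ⟨J₀, hJ₀⟩ := exists_linearIsometry_of_inner
    (fun ξ : H 0 => (lp.single 2 0 ξ : lp H 2)) fun ξ η => by
      rw [lp.inner_single_left, lp.single_apply_self]
  choose next hnext hcomp using exists_extension_to_hilbertSum H V
  let J' : ∀ n, {J : H n →ₗᵢ[ℂ] lp H 2 // ∀ ξ k, n < k → J ξ k = 0} := fun n =>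
    Nat.rec ⟨J₀, fun ξ k hk => by rw [hJ₀, lp.single_apply_ne _ _ _ hk.ne']⟩
      (fun n J => ⟨next n J.1 J.2, hnext n J.1 J.2⟩) n
  have hJ' (n ξ) : (J' (n + 1)).1 (V n ξ) = (J' n).1 ξ := hcomp n (J' n).1 (J' n).2 ξ
  let R (n : ℕ) : Submodule ℂ (lp H 2) := LinearMap.range (J' n).1.toLinearMap
  have hR : Monotone R := monotone_nat_of_le_succ fun n => by
    rintro _ ⟨ξ, rfl⟩
    exact ⟨V n ξ, hJ' n ξ⟩
  let K := (⨆ n, R n).topologicalClosure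
  have hmem (n) (ξ : H n) : (J' n).1 ξ ∈ K :=
    Submodule.le_topologicalClosure _ (Submodule.mem_iSup_of_mem n ⟨ξ, rfl⟩)
  have hex (n) := exists_linearIsometry_of_inner (fun ξ : H n => (⟨(J' n).1 ξ, hmem n ξ⟩ : K))
    fun ξ η => (J' n).1.inner_map_map ξ η
  choose J hJ using hex
  refine ⟨K, inferInstance, inferInstance,
    (Submodule.isClosed_topologicalClosure _).completeSpace_coe, J, fun n ξ => ?_, ?_⟩
  · rw [hJ, hJ]
    exact Subtype.ext (hJ' n ξ)
  · rw [Subtype.dense_iff]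
    have : (K : Set (lp H 2)) = closure (⋃ n, (R n : Set (lp H 2))) := by
      rw [← Submodule.coe_iSup_of_directed _ hR.directed_le]
      rfl
    refine this.subset.trans (closure_mono ?_)
    rintro k hk
    obtain ⟨n, ξ, rfl⟩ := Set.mem_iUnion.mp hk
    exact ⟨J n ξ, Set.mem_iUnion.mpr ⟨n, ξ, rfl⟩, by rw [hJ]; rfl⟩

end HilbertLimit

/-- A bounded sequence of operators has a weak limit along every ultrafilter. -/
lemma exists_weak_limit {K : Type*} [NormedAddCommGroup K] [InnerProductSpace ℂ K]
    [CompleteSpace K] {ι : Type*} (U : Ultrafilter ι) (T : ι → K →L[ℂ] K) (C : ℝ)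
    (hC : ∀ n, ‖T n‖ ≤ C) :
    ∃ T' : K →L[ℂ] K, ∀ ξ η, Tendsto (fun n => ⟪ξ, T n η⟫_ℂ) U (𝓝 ⟪ξ, T' η⟫_ℂ) := by
  have hbound (ξ η : K) (n) : ‖⟪ξ, T n η⟫_ℂ‖ ≤ C * ‖ξ‖ * ‖η‖ :=
    calc ‖⟪ξ, T n η⟫_ℂ‖ ≤ ‖ξ‖ * ‖T n η‖ := norm_inner_le_norm _ _
      _ ≤ ‖ξ‖ * (C * ‖η‖) := by gcongr; exact (T n).le_of_opNorm_le (hC n) η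
      _ = C * ‖ξ‖ * ‖η‖ := by ring
  have hlim (ξ η : K) : ∃ l ∈ Metric.closedBall (0 : ℂ) (C * ‖ξ‖ * ‖η‖),
      Tendsto (fun n => ⟪ξ, T n η⟫_ℂ) U (𝓝 l) := by
    refine (isCompact_closedBall (0 : ℂ) (C * ‖ξ‖ * ‖η‖)).ultrafilter_le_nhds
      (U.map fun n => ⟪ξ, T n η⟫_ℂ) ?_
    simp only [le_principal_iff, Ultrafilter.coe_map, Filter.mem_map]
    exact Filter.univ_mem' fun n => by simpa using hbound ξ η n
  choose l hl hT using hlim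
  let B : K →ₗ⋆[ℂ] K →ₗ[ℂ] ℂ := LinearMap.mk₂'ₛₗ _ _ l
    (fun ξ ξ' η => tendsto_nhds_unique (hT _ _) (by
      simpa only [inner_add_left] using (hT ξ η).add (hT ξ' η)))
    (fun c ξ η => tendsto_nhds_unique (hT _ _) (by
      simpa only [inner_smul_left, smul_eq_mul] using (hT ξ η).const_mul (starRingEnd ℂ c)))
    (fun ξ η η' => tendsto_nhds_unique (hT _ _) (by
      simpa only [map_add, inner_add_right] using (hT ξ η).add (hT ξ η')))
    (fun c ξ η => tendsto_nhds_unique (hT _ _) (by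
      simpa only [map_smul, inner_smul_right, smul_eq_mul, RingHom.id_apply] using (hT ξ η).const_mul c))
  let B' : K →L⋆[ℂ] K →L[ℂ] ℂ := B.mkContinuous₂ C fun ξ η =>
    mem_closedBall_zero_iff.mp (hl ξ η)
  refine ⟨adjoint (InnerProductSpace.continuousLinearMapOfBilin B'), fun ξ η => ?_⟩
  rw [ContinuousLinearMap.adjoint_inner_right, InnerProductSpace.continuousLinearMapOfBilin_apply]
  exact hT ξ η

lemma separableSpace_of_dense_iUnion_range {K : Type*} [TopologicalSpace K]
    [TopologicalSpace.PseudoMetrizableSpace K] {H : ℕ → Type*}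
    [∀ n, TopologicalSpace (H n)] [∀ n, TopologicalSpace.SeparableSpace (H n)] {J : ∀ n, H n → K}
    (hJ : ∀ n, Continuous (J n)) (hd : Dense (⋃ n, Set.range (J n))) :
    TopologicalSpace.SeparableSpace K := by
  rw [← TopologicalSpace.isSeparable_univ_iff, ← hd.closure_eq]
  exact (TopologicalSpace.IsSeparable.iUnion fun n =>
    TopologicalSpace.isSeparable_range (hJ n)).closure

variable {A : Type u} [CStarAlgebra A] [PartialOrder A] [StarOrderedRing A] {S : OperatorSystem A}

/-- The limit of a sequence of successive dilations. -/
theorem exists_dilation_limit (H : ℕ → Type v) [∀ n, NormedAddCommGroup (H n)]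
    [∀ n, InnerProductSpace ℂ (H n)] [∀ n, CompleteSpace (H n)]
    [∀ n, TopologicalSpace.SeparableSpace (H n)]
    (V : ∀ n, H n →ₗᵢ[ℂ] H (n + 1)) (φ : ∀ n, S.OpMap (H n)) (hφ : ∀ n, IsUCP (φ n))
    (hV : ∀ n, IsDilation (φ n) (V n) (φ (n + 1))) :
    ∃ (K : Type v) (_ : NormedAddCommGroup K) (_ : InnerProductSpace ℂ K) (_ : CompleteSpace K)
      (J : ∀ n, H n →ₗᵢ[ℂ] K) (ψ : S.OpMap K), TopologicalSpace.SeparableSpace K ∧ IsUCP ψ ∧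
      (∀ n, IsDilation (φ n) (J n) ψ) ∧ (∀ n ξ, J (n + 1) (V n ξ) = J n ξ) ∧
      Dense (⋃ n, Set.range (J n)) := by
  obtain ⟨K, _, _, _, J, hJ, hd⟩ := exists_hilbert_limit H V
  have hW (m n : ℕ) (hmn : m ≤ n) : ∃ W : H m →ₗᵢ[ℂ] H n, (∀ ξ, J n (W ξ) = J m ξ) ∧
      IsDilation (φ m) W (φ n) := by
    induction n, hmn using Nat.le_induction with
    | base => exact ⟨LinearIsometry.id, fun _ => rfl, IsDilation.refl _⟩
    | succ n _ ih =>
      obtain ⟨W, h1, h2⟩ := ih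
      exact ⟨(V n).comp W, fun ξ => by simp [hJ, h1], h2.trans (hV n)⟩
  let Q (n : ℕ) : K →L[ℂ] H n := adjoint (J n).toContinuousLinearMap
  have hQ (n) (ξ : K) (η : H n) : ⟪ξ, J n η⟫_ℂ = ⟪Q n ξ, η⟫_ℂ :=
    (ContinuousLinearMap.adjoint_inner_left (J n).toContinuousLinearMap η ξ).symm
  let U : Ultrafilter ℕ := Filter.hyperfilter ℕ
  have hU : ∀ {p : ℕ → Prop}, (∀ᶠ n in atTop, p n) → ∀ᶠ n in (U : Filter ℕ), p n := fun hp =>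
    Nat.hyperfilter_le_atTop hp
  -- `φ n` is transported to `K` and extended by zero. The bound `‖x‖`, uniform in `n`, provides
  -- weak limits on all of `K`.
  let T (x : S.toSubmodule) (n : ℕ) : K →L[ℂ] K :=
    (J n).toContinuousLinearMap ∘L φ n x ∘L Q n
  have hT (x n ξ η) : ⟪ξ, T x n η⟫_ℂ = ⟪Q n ξ, φ n x (Q n η)⟫_ℂ := hQ n _ _
  have hTn (x n) : ‖T x n‖ ≤ ‖x‖ := by
    refine ContinuousLinearMap.opNorm_le_bound _ (norm_nonneg _) fun ξ => ?_
    have : ‖T x n ξ‖ = ‖φ n x (Q n ξ)‖ := (J n).norm_map _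
    rw [this]
    refine ((hφ n).norm_apply_le _ _).trans ?_
    gcongr
    exact norm_adjoint_apply_le _ _
  have hex (x) := exists_weak_limit U (T x) ‖x‖ (hTn x)
  choose ψ' hψ' using hex
  have uniq {x ξ η l} (h : Tendsto (fun n => ⟪ξ, T x n η⟫_ℂ) U (𝓝 l)) : ⟪ξ, ψ' x η⟫_ℂ = l :=
    tendsto_nhds_unique (hψ' x ξ η) h
  let ψ : S.OpMap K :=
    { toFun := ψ'
      map_add' := fun x y => by
        ext η
        refine ext_inner_left ℂ fun ξ => uniq ?_
        simpa only [hT, map_add, _root_.add_apply, inner_add_right] using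
          (hψ' x ξ η).add (hψ' y ξ η)
      map_smul' := fun c x => by
        ext η
        refine ext_inner_left ℂ fun ξ => uniq ?_
        simpa only [hT, map_smul, _root_.smul_apply, inner_smul_right, RingHom.id_apply] using
          (hψ' x ξ η).const_mul c }
  have hQW {m n : ℕ} (W : H m →ₗᵢ[ℂ] H n) (h : ∀ ξ, J n (W ξ) = J m ξ) (ξ) :
      Q n (J m ξ) = W ξ := by
    rw [← h]
    exact adjoint_apply_self (J n) _
  -- Coefficients at vectors from stage `m` are constant for `n ≥ m`, so the ultrafilter limit has
  -- the right value there.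
  have hdil (m) : IsDilation (φ m) (J m) ψ := by
    refine isDilation_iff.mpr fun x ξ η => uniq (tendsto_const_nhds.congr' (hU ?_))
    filter_upwards [eventually_ge_atTop m] with n hn
    obtain ⟨W, h1, h2⟩ := hW m n hn
    rw [hT, hQW W h1, hQW W h1, h2.inner_eq]
  refine ⟨K, _, _, _, J, ψ,
    separableSpace_of_dense_iUnion_range (fun n => (J n).continuous) hd, ⟨?_, ?_⟩, hdil, hJ, hd⟩
  · refine ContinuousLinearMap.coeFn_injective
      (Continuous.ext_on hd (ContinuousLinearMap.continuous _) (ContinuousLinearMap.continuous _) ?_)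
    intro k hk
    obtain ⟨m, η, rfl⟩ := Set.mem_iUnion.mp hk
    refine ext_inner_left ℂ fun ξ => uniq (tendsto_const_nhds.congr' (hU ?_))
    filter_upwards [eventually_ge_atTop m] with n hn
    obtain ⟨W, h1, -⟩ := hW m n hn
    rw [hT, (hφ n).map_one, hQW W h1, one_apply_eq_self, one_apply_eq_self, ← hQ, h1]
  · refine isCompletelyPositive_iff.mpr fun n M hM ξ => ?_
    have h := tendsto_finsetSum Finset.univ fun i _ => tendsto_finsetSum Finset.univ fun j _ =>
      hψ' (M i j) (ξ i) (ξ j)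
    refine ge_of_tendsto' h fun k => ?_
    simp only [hT]
    exact (hφ k).completelyPositive.sum_inner_nonneg M hM fun i => Q k (ξ i)

end OperatorSystem

/-! ### Separable dilations with extremal norms. -/

namespace OperatorSystem

open Filter Topology

variable {A : Type u} [CStarAlgebra A] [PartialOrder A] [StarOrderedRing A] {S : OperatorSystem A}
  {H : Type v} [NormedAddCommGroup H] [InnerProductSpace ℂ H] [CompleteSpace H]

lemma IsUCP.continuous {φ : S.OpMap H} (hφ : IsUCP φ) : Continuous φ :=
  (φ.mkContinuous 1 fun x => by simpa using hφ.opNorm_le x).continuous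

lemma IsUCP.continuous_apply {φ : S.OpMap H} (hφ : IsUCP φ) {K : Type*} [NormedAddCommGroup K]
    [InnerProductSpace ℂ K] (V : K →ₗᵢ[ℂ] H) :
    Continuous fun p : S.toSubmodule × K => φ p.1 (V p.2) :=
  (hφ.continuous.comp continuous_fst).clm_apply (V.continuous.comp continuous_snd)

/-- A unital completely positive dilation of `φ` on a separable Hilbert space. -/
structure SeparableDilation (φ : S.OpMap H) where
  /-- The Hilbert space on which the dilation acts. -/
  space : Type v
  [normedAddCommGroup : NormedAddCommGroup space]
  [innerProductSpace : InnerProductSpace ℂ space]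
  [completeSpace : CompleteSpace space]
  [separableSpace : TopologicalSpace.SeparableSpace space]
  /-- The embedding of the original Hilbert space. -/
  emb : H →ₗᵢ[ℂ] space
  /-- The dilated map. -/
  map : S.OpMap space
  isUCP : IsUCP map
  isDilation : IsDilation φ emb map

namespace SeparableDilation

attribute [instance] normedAddCommGroup innerProductSpace completeSpace separableSpace

/-- The trivial dilation. -/
def refl [TopologicalSpace.SeparableSpace H] {φ : S.OpMap H} (hφ : IsUCP φ) :
    SeparableDilation φ :=
  ⟨H, LinearIsometry.id, φ, hφ, IsDilation.refl φ⟩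

variable {φ : S.OpMap H}

/-- A dilation of a dilation. -/
def trans (D : SeparableDilation φ) (E : SeparableDilation D.map) : SeparableDilation φ :=
  ⟨E.space, E.emb.comp D.emb, E.map, E.isUCP, D.isDilation.trans E.isDilation⟩

lemma norm_le_trans (D : SeparableDilation φ) (E : SeparableDilation D.map) (x ξ) :
    ‖D.map x (D.emb ξ)‖ ≤ ‖(D.trans E).map x ((D.trans E).emb ξ)‖ :=
  E.isDilation.norm_le x (D.emb ξ)

/-- The limit of a sequence of dilations, each dilating the preceding one. -/
lemma exists_limit (D : ℕ → SeparableDilation φ) (E : ∀ n, SeparableDilation (D n).map)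
    (hD : ∀ n, D (n + 1) = (D n).trans (E n)) :
    ∃ (L : SeparableDilation φ) (J : ∀ n, (D n).space →ₗᵢ[ℂ] L.space),
      (∀ n, IsDilation (D n).map (J n) L.map) ∧ (∀ n ξ, J n ((D n).emb ξ) = L.emb ξ) ∧
      (∀ k ∈ ⋃ n, Set.range (J n), ∃ n, ∃ ξ : (D n).space, ∃ W : (E n).space →ₗᵢ[ℂ] L.space,
        IsDilation (E n).map W L.map ∧ W ((E n).emb ξ) = k) ∧
      Dense (⋃ n, Set.range (J n)) := by
  have hV (n) : ∃ V : (D n).space →ₗᵢ[ℂ] (D (n + 1)).space,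
      IsDilation (D n).map V (D (n + 1)).map ∧ (∀ ξ, V ((D n).emb ξ) = (D (n + 1)).emb ξ) ∧
      ∃ W : (E n).space →ₗᵢ[ℂ] (D (n + 1)).space,
        IsDilation (E n).map W (D (n + 1)).map ∧ ∀ ξ, W ((E n).emb ξ) = V ξ := by
    -- The hypothesis is only a propositional equality; stating the maps existentially avoids
    -- transport along it.
    rw [hD n]
    exact ⟨(E n).emb, (E n).isDilation, fun _ => rfl, LinearIsometry.id, IsDilation.refl _,
      fun _ => rfl⟩
  choose V hV1 hV2 W hW1 hW2 using hV
  obtain ⟨K, _, _, _, J, ψ, hsep, hψ, hdil, hJ, hd⟩ := exists_dilation_limit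
    (fun n => (D n).space) V (fun n => (D n).map) (fun n => (D n).isUCP) hV1
  have hJ0 (n ξ) : J n ((D n).emb ξ) = J 0 ((D 0).emb ξ) := by
    induction n with
    | zero => rfl
    | succ n ih => rw [← hV2, hJ, ih]
  refine ⟨⟨K, (J 0).comp (D 0).emb, ψ, hψ, (D 0).isDilation.trans (hdil 0)⟩, J, hdil, hJ0,
    fun k hk => ?_, hd⟩
  obtain ⟨n, ξ, rfl⟩ := Set.mem_iUnion.mp hk
  exact ⟨n, ξ, (J (n + 1)).comp (W n), (hW1 n).trans (hdil (n + 1)), by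
    rw [LinearIsometry.coe_comp, Function.comp_apply, hW2, hJ]⟩

section Weight

variable [TopologicalSpace.SeparableSpace S.toSubmodule] [TopologicalSpace.SeparableSpace H]

/-- The weighted norms `‖φ(x) ξ‖` along a dense sequence of pairs `(x, ξ)`. -/
noncomputable def term (D : SeparableDilation φ) (k : ℕ) : ℝ :=
  let p := TopologicalSpace.denseSeq (S.toSubmodule × H) k
  (1 / 2) ^ k / (1 + ‖p.1‖ * ‖p.2‖) * ‖D.map p.1 (D.emb p.2)‖

lemma term_nonneg (D : SeparableDilation φ) (k : ℕ) : 0 ≤ D.term k := by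
  unfold term
  positivity

/-- Contractivity bounds the norm by `‖x‖ * ‖ξ‖`, which the denominator absorbs, so the bound does
not depend on `D`. -/
lemma term_le (D : SeparableDilation φ) (k : ℕ) : D.term k ≤ (1 / 2) ^ k := by
  unfold term
  simp only
  set p := TopologicalSpace.denseSeq (S.toSubmodule × H) k
  have h := D.isUCP.norm_apply_le p.1 (D.emb p.2)
  rw [D.emb.norm_map] at h
  have h0 : 0 ≤ ‖p.1‖ * ‖p.2‖ := by positivity
  rw [div_mul_eq_mul_div, div_le_iff₀ (by positivity)]
  gcongr
  linarith

lemma summable_term (D : SeparableDilation φ) : Summable D.term :=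
  Summable.of_nonneg_of_le D.term_nonneg D.term_le summable_geometric_two

/-- The sum of the weighted norms. -/
noncomputable def weight (D : SeparableDilation φ) : ℝ := ∑' k, D.term k

lemma weight_le_two (D : SeparableDilation φ) : D.weight ≤ 2 :=
  (D.summable_term.tsum_le_tsum D.term_le summable_geometric_two).trans_eq tsum_geometric_two

lemma term_mono {D D' : SeparableDilation φ}
    (h : ∀ x ξ, ‖D.map x (D.emb ξ)‖ ≤ ‖D'.map x (D'.emb ξ)‖) (k : ℕ) : D.term k ≤ D'.term k := by
  simp only [term]
  gcongr
  exact h _ _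

lemma weight_mono {D D' : SeparableDilation φ}
    (h : ∀ x ξ, ‖D.map x (D.emb ξ)‖ ≤ ‖D'.map x (D'.emb ξ)‖) : D.weight ≤ D'.weight :=
  D.summable_term.tsum_le_tsum (term_mono h) D'.summable_term

/-- Two termwise ordered convergent series with equal sums agree termwise. The weights are positive,
so the norms agree at the dense pairs, and by joint continuity at all pairs. -/
lemma norm_le_of_weight_le {D D' : SeparableDilation φ}
    (h : ∀ x ξ, ‖D.map x (D.emb ξ)‖ ≤ ‖D'.map x (D'.emb ξ)‖) (hw : D'.weight ≤ D.weight)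
    (x ξ) : ‖D'.map x (D'.emb ξ)‖ ≤ ‖D.map x (D.emb ξ)‖ := by
  have hterm (k) : D'.term k ≤ D.term k := by
    by_contra! hlt
    exact (Summable.tsum_lt_tsum (term_mono h) hlt D.summable_term D'.summable_term).not_ge hw
  have hcl : IsClosed {p : S.toSubmodule × H |
      ‖D'.map p.1 (D'.emb p.2)‖ ≤ ‖D.map p.1 (D.emb p.2)‖} :=
    isClosed_le (D'.isUCP.continuous_apply _).norm (D.isUCP.continuous_apply _).norm
  have hsub : Set.range (TopologicalSpace.denseSeq (S.toSubmodule × H)) ⊆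
      {p : S.toSubmodule × H | ‖D'.map p.1 (D'.emb p.2)‖ ≤ ‖D.map p.1 (D.emb p.2)‖} := by
    rintro _ ⟨k, rfl⟩
    exact le_of_mul_le_mul_left (hterm k) (by positivity)
  have := (hcl.closure_subset_iff.mpr hsub)
    ((TopologicalSpace.denseRange_denseSeq (S.toSubmodule × H)) (x, ξ))
  exact this

/-- `E` comes within `ε` of the supremum of the weights; a dilation of `E` is again a dilation of
`D`, so it stays below the same supremum. -/
lemma exists_weight_almost_maximal (D : SeparableDilation φ) {ε : ℝ} (hε : 0 < ε) :
    ∃ E : SeparableDilation D.map, ∀ E' : SeparableDilation E.map,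
      ((D.trans E).trans E').weight ≤ (D.trans E).weight + ε := by
  let s := Set.range fun E : SeparableDilation D.map => (D.trans E).weight
  have hs : s.Nonempty := ⟨_, refl D.isUCP, rfl⟩
  have hb : BddAbove s := ⟨2, by rintro _ ⟨E, rfl⟩; exact weight_le_two _⟩
  obtain ⟨_, ⟨E, rfl⟩, hE⟩ := exists_lt_of_lt_csSup hs (sub_lt_self (sSup s) hε)
  refine ⟨E, fun E' => ?_⟩
  have h1 : ((D.trans E).trans E').weight ≤ sSup s := le_csSup hb ⟨E.trans E', rfl⟩
  simp only at hE
  linarith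

/-- A dilation that no further dilation increases on the original Hilbert space. -/
lemma exists_maximal_on (hφ : IsUCP φ) : ∃ D : SeparableDilation φ,
    ∀ (E : SeparableDilation D.map) (x ξ),
      ‖E.map x (E.emb (D.emb ξ))‖ ≤ ‖D.map x (D.emb ξ)‖ := by
  have hstep (D : SeparableDilation φ) (n : ℕ) := D.exists_weight_almost_maximal
    (Nat.one_div_pos_of_nat (α := ℝ) (n := n))
  choose next hnext using hstep
  let D : ℕ → SeparableDilation φ := fun n =>
    Nat.rec (refl hφ) (fun n D => D.trans (next D n)) n
  have hD (n) : D (n + 1) = (D n).trans (next (D n) n) := rfl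
  obtain ⟨L, J, hJ, hemb, -, -⟩ := exists_limit D (fun n => next (D n) n) hD
  refine ⟨L, fun E x ξ => norm_le_of_weight_le (norm_le_trans L E) ?_ x ξ⟩
  refine le_of_forall_pos_le_add fun ε hε => ?_
  obtain ⟨n, hn⟩ := exists_nat_one_div_lt hε
  -- A dilation of the limit also dilates stage `n + 1`, which was chosen almost maximal.
  have h1 : (L.trans E).weight ≤ (D (n + 1)).weight + 1 / (n + 1 : ℝ) := by
    let E' : SeparableDilation (D (n + 1)).map :=
      ⟨E.space, E.emb.comp (J (n + 1)), E.map, E.isUCP, (hJ (n + 1)).trans E.isDilation⟩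
    refine le_trans ?_ (hnext (D n) n E')
    refine weight_mono fun x ξ => le_of_eq ?_
    change ‖E.map x (E.emb (L.emb ξ))‖ = ‖E.map x (E.emb (J (n + 1) ((D (n + 1)).emb ξ)))‖
    rw [hemb]
  have h2 : (D (n + 1)).weight ≤ L.weight := weight_mono fun x ξ => by
    rw [← hemb (n + 1)]
    exact (hJ (n + 1)).norm_le x _
  linarith

/-- A dilation that no further dilation increases. -/
lemma exists_maximal (hφ : IsUCP φ) : ∃ D : SeparableDilation φ,
    ∀ (E : SeparableDilation D.map) (x ξ), E.map x (E.emb ξ) = E.emb (D.map x ξ) := by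
  have hstep (D : SeparableDilation φ) := exists_maximal_on D.isUCP
  choose next hnext using hstep
  let D : ℕ → SeparableDilation φ := fun n =>
    Nat.rec (refl hφ) (fun _ D => D.trans (next D)) n
  have hD (n) : D (n + 1) = (D n).trans (next (D n)) := rfl
  obtain ⟨L, J, -, -, hL, hd⟩ := exists_limit D (fun n => next (D n)) hD
  refine ⟨L, fun E x k => E.isDilation.apply_of_norm_le ?_⟩
  have hcl : IsClosed {k | ‖E.map x (E.emb k)‖ ≤ ‖L.map x k‖} :=
    isClosed_le ((E.map x).continuous.comp E.emb.continuous).norm (L.map x).continuous.norm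
  refine hcl.closure_subset_iff.mpr (fun k hk => ?_) (hd k)
  -- A vector `k` of stage `n` has frozen norms already in `next (D n)`, and `E` dilates that map
  -- through `L`.
  obtain ⟨n, ξ, W, hW, rfl⟩ := hL k hk
  exact (hnext (D n) ⟨E.space, E.emb.comp W, E.map, E.isUCP, hW.trans E.isDilation⟩ x ξ).trans
    (hW.norm_le x _)

end Weight

end SeparableDilation

end OperatorSystem

/-! ### From invariance to maximality and the unique extension property. -/

namespace OperatorSystem

open ContinuousLinearMap (adjoint)

section Invariant

variable {A : Type u} [CStarAlgebra A] [PartialOrder A] [StarOrderedRing A] {S : OperatorSystem A}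
  {H : Type v} [NormedAddCommGroup H] [InnerProductSpace ℂ H] [CompleteSpace H]

/-- If no dilation on a separable Hilbert space changes `φ` off the original space, then no
dilation does. -/
lemma IsDilation.apply_of_maximal [TopologicalSpace.SeparableSpace S.toSubmodule]
    [TopologicalSpace.SeparableSpace H] {φ : S.OpMap H}
    (hmax : ∀ (E : SeparableDilation φ) (x ξ), E.map x (E.emb ξ) = E.emb (φ x ξ))
    {K : Type w} [NormedAddCommGroup K] [InnerProductSpace ℂ K] [CompleteSpace K]
    {V : H →ₗᵢ[ℂ] K} {ψ : S.OpMap K} (hψ : IsUCP ψ) (h : IsDilation φ V ψ) (x ξ) :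
    ψ x (V ξ) = V (φ x ξ) := by
  -- `M` is a separable subspace containing `V H` and all `ψ x (V ξ)`. A copy of it in the universe
  -- of `H` gives a dilation to which `hmax` applies.
  let s : Set K := Set.range fun p : S.toSubmodule × H => ψ p.1 (V p.2)
  let M : Submodule ℂ K := (Submodule.span ℂ s).topologicalClosure
  have hMs (x ξ) : ψ x (V ξ) ∈ M :=
    Submodule.le_topologicalClosure _ (Submodule.subset_span ⟨(x, ξ), rfl⟩)
  have hMV (ξ) : V ξ ∈ M := by simpa [hψ.map_one] using hMs ⟨1, S.one_mem'⟩ ξ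
  have : CompleteSpace M := (Submodule.isClosed_topologicalClosure _).completeSpace_coe
  have : TopologicalSpace.SeparableSpace M :=
    (TopologicalSpace.isSeparable_range (hψ.continuous_apply V)).span.closure.separableSpace
  obtain ⟨L, _, _, _, _, ⟨e⟩⟩ := exists_linearIsometryEquiv_of_separable.{v} M
  let U : L →ₗᵢ[ℂ] K := M.subtypeₗᵢ.comp e.toLinearIsometry
  have hU {k} (hk : k ∈ M) : ∃ l, U l = k := ⟨e.symm ⟨k, hk⟩, by simp [U]⟩
  choose f hf using fun ξ => hU (hMV ξ)
  obtain ⟨V', hV'⟩ := exists_linearIsometry_of_inner f fun ξ η => by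
    rw [← U.inner_map_map, hf, hf, V.inner_map_map]
  have hUV (ξ) : U (V' ξ) = V ξ := by rw [hV', hf]
  have hd := isDilation_compress U ψ
  let E : SeparableDilation φ := ⟨L, V', compress U ψ, hd.isUCP hψ, isDilation_iff.mpr
    fun x ξ η => by rw [← hd.inner_eq, hUV, hUV, h.inner_eq]⟩
  have hE : compress U ψ x (V' ξ) = V' (φ x ξ) := hmax E x ξ
  -- The difference to be shown zero lies in `M`, so its squared norm can be computed in the
  -- compression to `L`.
  obtain ⟨l, hl⟩ := hU (M.sub_mem (hMs x ξ) (hMV (φ x ξ)))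
  rw [← sub_eq_zero, ← inner_self_eq_zero (𝕜 := ℂ)]
  nth_rewrite 1 [← hl]
  rw [inner_sub_right, ← hUV, ← hUV, hd.inner_eq, hE, U.inner_map_map, sub_self]

end Invariant

section Extension

variable {A : Type u} [CStarAlgebra A] [PartialOrder A] [StarOrderedRing A] {S : OperatorSystem A}
  {H : Type*} [NormedAddCommGroup H] [InnerProductSpace ℂ H] [CompleteSpace H]

/-- The whole C⋆-algebra as an operator system. -/
noncomputable def whole (A : Type u) [CStarAlgebra A] : OperatorSystem A where
  toSubmodule := ⊤
  one_mem' := trivial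
  star_mem' _ := trivial
  generates' := by
    rw [eq_top_iff]
    refine le_trans ?_ (StarSubalgebra.le_topologicalClosure _)
    exact fun a _ => StarAlgebra.subset_adjoin ℂ _ trivial

/-- Stinespring's theorem for unital completely positive maps on a C⋆-algebra. -/
lemma exists_stinespring {A : Type u} [CStarAlgebra A] [PartialOrder A] [StarOrderedRing A]
    {H : Type v} [NormedAddCommGroup H] [InnerProductSpace ℂ H] [CompleteSpace H]
    (ψ : A →CP (H →L[ℂ] H)) (h1 : ψ 1 = 1) :
    ∃ (K : Type (max u v)) (_ : NormedAddCommGroup K) (_ : InnerProductSpace ℂ K)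
      (_ : CompleteSpace K) (π : A →⋆ₐ[ℂ] (K →L[ℂ] K)) (V : H →ₗᵢ[ℂ] K),
      ∀ (a : A) (ξ η : H), ⟪V ξ, π a (V η)⟫_ℂ = ⟪ξ, ψ a η⟫_ℂ := by
  let φ : (whole A).OpMap H := ψ.toLinearMap ∘ₗ (whole A).toSubmodule.subtype
  have hφ : IsUCP φ := ⟨h1, fun n M hM => ψ.map_cstarMatrix_nonneg' n _ hM⟩
  obtain ⟨K, _, _, _, π, V, h⟩ := hφ.exists_representation
  exact ⟨K, _, _, _, π, V, fun a => h ⟨a, trivial⟩⟩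

/-- A closed ⋆-subalgebra containing the operator system is everything. -/
lemma induction_on_generators (S : OperatorSystem A) {p : A → Prop}
    (hS : ∀ x : S.toSubmodule, p x) (hadd : ∀ a b, p a → p b → p (a + b))
    (hmul : ∀ a b, p a → p b → p (a * b)) (halg : ∀ r : ℂ, p (algebraMap ℂ A r))
    (hstar : ∀ a, p a → p (star a)) (hcl : IsClosed {a | p a}) (a : A) : p a := by
  have h : (a : A) ∈ (StarAlgebra.adjoin ℂ (S.carrier : Set A)).topologicalClosure := by
    rw [S.generates']; trivial
  refine hcl.closure_subset_iff.mpr (fun b hb => ?_) h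
  induction hb using StarAlgebra.adjoin_induction with
  | mem x hx => exact hS ⟨x, hx⟩
  | algebraMap r => exact halg r
  | add a b _ _ ha hb => exact hadd a b ha hb
  | mul a b _ _ ha hb => exact hmul a b ha hb
  | star a _ ha => exact hstar a ha

variable {K : Type*} [NormedAddCommGroup K] [InnerProductSpace ℂ K] [CompleteSpace K]

/-- A subspace that is invariant under the operator system is invariant under the C⋆-algebra. -/
lemma mem_range_of_invariant (S : OperatorSystem A) (π : A →⋆ₐ[ℂ] (K →L[ℂ] K)) (V : H →ₗᵢ[ℂ] K)
    (h : ∀ (x : S.toSubmodule) ξ, π (x : A) (V ξ) ∈ Set.range V) (a : A) (ξ : H) :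
    π a (V ξ) ∈ Set.range V := by
  have hc (η) : Continuous fun a => π a (V η) :=
    (map_continuous π).clm_apply continuous_const
  have hr : IsClosed (Set.range V) := V.isometry.isClosedEmbedding.isClosed_range
  -- Invariance under `a` alone is not stable under adjoints, so `a` and `star a` are carried
  -- together.
  suffices H : ∀ a, (∀ ξ, π a (V ξ) ∈ Set.range V) ∧ ∀ ξ, π (star a) (V ξ) ∈ Set.range V from
    (H a).1 ξ
  refine induction_on_generators S (fun x => ⟨h x, h (adj x)⟩) ?_ ?_ ?_ ?_ ?_
  · rintro a b ⟨ha, ha'⟩ ⟨hb, hb'⟩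
    constructor <;> intro ξ
    · obtain ⟨η, hη⟩ := ha ξ
      obtain ⟨ζ, hζ⟩ := hb ξ
      exact ⟨η + ζ, by simp [hη, hζ]⟩
    · obtain ⟨η, hη⟩ := ha' ξ
      obtain ⟨ζ, hζ⟩ := hb' ξ
      exact ⟨η + ζ, by simp only [map_add, star_add, hη, hζ, _root_.add_apply]⟩
  · rintro a b ⟨ha, ha'⟩ ⟨hb, hb'⟩
    constructor <;> intro ξ
    · obtain ⟨η, hη⟩ := hb ξ
      rw [map_mul, mul_apply_eq_comp, ← hη]
      exact ha η
    · obtain ⟨η, hη⟩ := ha' ξ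
      rw [star_mul, map_mul, mul_apply_eq_comp, ← hη]
      exact hb' η
  · have hr (r : ℂ) (ξ) : π (algebraMap ℂ A r) (V ξ) ∈ Set.range V :=
      ⟨r • ξ, by simp [Algebra.algebraMap_eq_smul_one]⟩
    exact fun r => ⟨hr r, by simpa only [← algebraMap_star_comm] using hr (star r)⟩
  · rintro a ⟨ha, ha'⟩
    exact ⟨ha', by simpa using ha⟩
  · simp only [Set.ofPred_and, Set.ofPred_forall]
    exact (isClosed_iInter fun ξ => hr.preimage (hc ξ)).inter
      (isClosed_iInter fun ξ => hr.preimage ((hc ξ).comp continuous_star))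

/-- The compression of a representation to an invariant subspace is a representation. -/
lemma exists_starAlgHom_of_invariant (π : A →⋆ₐ[ℂ] (K →L[ℂ] K)) (V : H →ₗᵢ[ℂ] K)
    (ψ : A →CP (H →L[ℂ] H)) (hψ : ∀ (a : A) (ξ η : H), ⟪V ξ, π a (V η)⟫_ℂ = ⟪ξ, ψ a η⟫_ℂ)
    (h : ∀ a ξ, π a (V ξ) ∈ Set.range V) : ∃ σ : A →⋆ₐ[ℂ] (H →L[ℂ] H), ∀ a, ψ a = σ a := by
  have hV (a ξ) : π a (V ξ) = V (ψ a ξ) := by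
    obtain ⟨ζ, hζ⟩ := h a ξ
    rw [← hζ]
    congr 1
    exact ext_inner_left ℂ fun η => by rw [← hψ, ← hζ, V.inner_map_map]
  have hone : ψ 1 = 1 := by
    ext ξ
    apply V.injective
    rw [← hV]
    simp
  exact ⟨{
    toFun := ψ
    map_one' := hone
    map_mul' := fun a b => by
      ext ξ
      apply V.injective
      rw [← hV, map_mul, mul_apply_eq_comp, hV, hV]
      rfl
    map_zero' := map_zero ψ
    map_add' := map_add ψ
    commutes' := fun r => by
      rw [Algebra.algebraMap_eq_smul_one, map_smul, hone, Algebra.algebraMap_eq_smul_one]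
    map_star' := fun a => by
      ext η
      refine ext_inner_left ℂ fun ξ => ?_
      rw [ContinuousLinearMap.star_eq_adjoint, ContinuousLinearMap.adjoint_inner_right, ← hψ,
        map_star, ContinuousLinearMap.star_eq_adjoint, ContinuousLinearMap.adjoint_inner_right, hV,
        V.inner_map_map] }, fun _ => rfl⟩

/-- A unital completely positive map has the unique extension property if its Hilbert space is
invariant under each of its unital completely positive dilations. -/
theorem hasUniqueExtensionProperty_of_invariant {A : Type u} [CStarAlgebra A] [PartialOrder A]
    [StarOrderedRing A] {S : OperatorSystem A}
    {H : Type v} [NormedAddCommGroup H] [InnerProductSpace ℂ H] [CompleteSpace H]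
    {φ : S.OpMap H} (hφ : IsUCP φ)
    (h : ∀ (K : Type (max u v)) [NormedAddCommGroup K] [InnerProductSpace ℂ K] [CompleteSpace K]
      (V : H →ₗᵢ[ℂ] K) (ψ : S.OpMap K), IsUCP ψ → IsDilation φ V ψ →
        ∀ x ξ, ψ x (V ξ) = V (φ x ξ)) :
    HasUniqueExtensionProperty φ := by
  have hrep (ψ : A →CP (H →L[ℂ] H)) (hψ : IsCPExtension φ ψ) :
      ∃ σ : A →⋆ₐ[ℂ] (H →L[ℂ] H), ∀ a, ψ a = σ a := by
    have h1 : ψ 1 = 1 := (hψ ⟨1, S.one_mem'⟩).trans hφ.map_one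
    obtain ⟨K, _, _, _, π, V, hV⟩ := exists_stinespring ψ h1
    refine exists_starAlgHom_of_invariant π V ψ hV (mem_range_of_invariant S π V fun x ξ => ?_)
    refine ⟨φ x ξ, (h K V (ofRep S π) (isUCP_ofRep π) (isDilation_iff.mpr fun x ξ η => ?_) x ξ).symm⟩
    rw [ofRep_apply, hV, hψ x]
  refine ⟨?_, hrep⟩
  -- Compressing a dilating representation gives one extension; any other is also a representation
  -- agreeing with it on `S`.
  obtain ⟨K, _, _, _, π, V, hV⟩ := hφ.exists_representation
  have hext : IsCPExtension φ (compressRep π V) := fun x => by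
    ext η
    refine ext_inner_left ℂ fun ξ => ?_
    rw [compressRep_apply, inner_compression, hV]
  refine ⟨compressRep π V, hext, fun ψ hψ => DFunLike.ext _ _ ?_⟩
  obtain ⟨σ, hσ⟩ := hrep _ hext
  obtain ⟨τ, hτ⟩ := hrep ψ hψ
  simp only [hσ, hτ]
  refine induction_on_generators S (fun x => ?_) (fun a b ha hb => ?_) (fun a b ha hb => ?_)
    (fun r => ?_) (fun a ha => ?_) (isClosed_eq (map_continuous τ) (map_continuous σ))
  · rw [← hσ, ← hτ, hext x, hψ x]
  · rw [map_add, map_add, ha, hb]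
  · rw [map_mul, map_mul, ha, hb]
  · rw [AlgHomClass.commutes, AlgHomClass.commutes]
  · rw [map_star, map_star, ha]

/-- A unital completely positive map is maximal if its Hilbert space is invariant under each of its
unital completely positive dilations. -/
theorem isMaximal_of_invariant {φ : S.OpMap H}
    (h : ∀ (K : Type w) [NormedAddCommGroup K] [InnerProductSpace ℂ K] [CompleteSpace K]
      (V : H →ₗᵢ[ℂ] K) (ψ : S.OpMap K), IsUCP ψ → IsDilation φ V ψ →
        ∀ x ξ, ψ x (V ξ) = V (φ x ξ)) :
    IsMaximal.{u, _, w} φ := by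
  intro K _ _ _ V ψ hψ hdil
  have hV := h K V ψ hψ hdil
  let N := (LinearMap.range V.toLinearMap)ᗮ
  have hd := isDilation_compress N.subtypeₗᵢ ψ
  refine ⟨compress N.subtypeₗᵢ ψ, hd.isUCP hψ, fun x ξ η => ?_⟩
  have hN : ψ x (η : K) ∈ N := by
    rw [Submodule.mem_orthogonal]
    rintro _ ⟨ζ, rfl⟩
    -- Invariance of `V H` under `ψ (adj x)` becomes invariance of its complement under `ψ x`.
    have h1 : ψ x = adjoint (ψ (adj x)) := by
      rw [← hψ.completelyPositive.map_adj]
      congr 1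
      exact Subtype.ext (star_star _).symm
    rw [h1, ContinuousLinearMap.adjoint_inner_right]
    exact (Submodule.mem_orthogonal _ _).mp η.2 _ ⟨φ (adj x) ζ, (hV (adj x) ζ).symm⟩
  have hη : compress N.subtypeₗᵢ ψ x η = ⟨ψ x (η : K), hN⟩ := by
    rw [hd.apply_eq]
    exact adjoint_apply_self N.subtypeₗᵢ ⟨ψ x (η : K), hN⟩
  rw [map_add, hV, hη]

end Extension

end OperatorSystem

end

theorem theorem2p4 {A : Type u} [CStarAlgebra A] [PartialOrder A] [StarOrderedRing A]
    (S : OperatorSystem A) [TopologicalSpace.SeparableSpace S.toSubmodule]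
    {H₀ : Type v} [NormedAddCommGroup H₀] [InnerProductSpace ℂ H₀] [CompleteSpace H₀]
    [TopologicalSpace.SeparableSpace H₀]
    (φ₀ : S.OpMap H₀) (hφ₀ : OperatorSystem.IsUCP φ₀) :
    ∃ (H : Type v) (_ : NormedAddCommGroup H) (_ : InnerProductSpace ℂ H) (_ : CompleteSpace H)
      (V : H₀ →ₗᵢ[ℂ] H) (φ : S.OpMap H),
      TopologicalSpace.SeparableSpace H ∧
      OperatorSystem.IsUCP φ ∧
      OperatorSystem.IsDilation φ₀ V φ ∧
      OperatorSystem.HasUniqueExtensionProperty φ ∧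
      OperatorSystem.IsMaximal.{u, v, w} φ := by
  obtain ⟨D, hD⟩ := OperatorSystem.SeparableDilation.exists_maximal hφ₀
  exact ⟨D.space, _, _, inferInstance, D.emb, D.map, inferInstance, D.isUCP, D.isDilation,
    OperatorSystem.hasUniqueExtensionProperty_of_invariant D.isUCP
      fun _ _ _ _ _ _ hψ hd => hd.apply_of_maximal hD hψ,
    OperatorSystem.isMaximal_of_invariant
      fun _ _ _ _ _ _ hψ hd => hd.apply_of_maximal hD hψ⟩
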